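/- Let $G$ be a finite group. A sequence over $G$ is a finite unordered sequence of terms from $G$ with repetition allowed, that is, an element of the free abelian monoid $\mathcal F(G)$ with basis $G$; its length is the number of its terms, counted with multiplicity. A sequence is a product-one sequence if its terms can be ordered so that their product is $1_G$ (the empty sequence is one), and it is product-one free if none of its nonempty subsequences is a product-one sequence. The product-one sequences form a submonoid $\mathcal B(G)$ of $\mathcal F(G)$. The large Davenport constant $\mathsf D(G)$ is the supremum of the lengths of the atoms (irreducible elements) of $\mathcal B(G)$, and the small Davenport constant $\mathsf d(G)$ is the supremum of the lengths of the product-one free sequences over $G$. Write $C_n$ for the cyclic group of order $n$, $D_{2n}$ for the dihedral group of order $2n$, and $Q_8$ for the quaternion group of order $8$. 1. If $|G| \ge 32$, then either $G \cong C_2^5$ and $\mathsf d(G) = 5$, or else $\mathsf d(G) \ge 6$. 2. $\mathsf D(G) = 6$ if and only if $G$ is isomorphic to one of the groups $C_6$, $C_2 \oplus C_2 \oplus C_4$, $C_2^5$, $D_6$, $Q_8$, $D_8$. 3. If $\mathsf D(G) \le 5$, then $G$ is abelian. -/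

import Mathlib

/-! Sequences over a group `G` are finite unordered sequences of terms from `G` with repetition
allowed, i.e. elements of the free abelian monoid with basis `G`. They are modelled by
`Multiset G`, so the monoid operation is written additively, the empty sequence is `0`, the
length is `Multiset.card` and "is a subsequence of" is `≤`. -/

namespace GroupSequence

/-- The set of products `π(S)`: all products of the terms of `S`, over all orderings of these
terms. For the empty sequence this is `{1}`. -/
def products {G : Type*} [Group G] (S : Multiset G) : Set G :=
  {g | ∃ l : List G, (l : Multiset G) = S ∧ l.prod = g}

/-- The set of subsequence products `Π(S)`: the union of all `π(T)`, where `T` runs over the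
nonempty subsequences of `S`. -/
def subproducts {G : Type*} [Group G] (S : Multiset G) : Set G :=
  {g | ∃ T : Multiset G, T ≤ S ∧ 1 ≤ Multiset.card T ∧ g ∈ products T}

/-- The terms of `S` can be ordered such that their product is the identity. -/
def IsProductOne {G : Type*} [Group G] (S : Multiset G) : Prop :=
  1 ∈ products S

/-- No nonempty subsequence of `S` is a product-one sequence. -/
def IsProductOneFree {G : Type*} [Group G] (S : Multiset G) : Prop :=
  1 ∉ subproducts S

/-- The monoid `𝓑(G)` of product-one sequences over `G`. -/
def productOneMonoid (G : Type*) [Group G] : AddSubmonoid (Multiset G) where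
  carrier := {S | IsProductOne S}
  zero_mem' := ⟨[], rfl, rfl⟩
  add_mem' := by
    rintro S T ⟨l, rfl, hl⟩ ⟨m, rfl, hm⟩
    exact ⟨l ++ m, (Multiset.coe_add l m).symm, by rw [List.prod_append, hl, hm, one_mul]⟩

/-- The large Davenport constant `D(G)`: the supremum of the lengths of the atoms (irreducible
elements) of the monoid `𝓑(G)`. -/
noncomputable def largeDavenport (G : Type*) [Group G] : ℕ∞ :=
  ⨆ S ∈ {S : productOneMonoid G | AddIrreducible S}, (Multiset.card (S : Multiset G) : ℕ∞)

/-- The small Davenport constant `d(G)`: the supremum of the lengths of the product-one free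
sequences over `G`. -/
noncomputable def smallDavenport (G : Type*) [Group G] : ℕ∞ :=
  ⨆ S ∈ {S : Multiset G | IsProductOneFree S}, (Multiset.card S : ℕ∞)

/-- The cyclic group `C_n` of order `n` (for `n ≥ 1`), written multiplicatively. -/
abbrev C (n : ℕ) : Type := Multiplicative (ZMod n)

end GroupSequence

/-! A product-one free sequence over an infinite group can always be extended, so `d(G) ≤ 5` forces
`G` to be finite. As `d` is superadditive along normal subgroups and increases strictly along
proper subgroups, the Sylow subgroups (and transfer to a self-normalizing one) leave for `|G|` only
`2 ^ a` and `3 * 2 ^ a` with small `a`, orders below `20` with an abelian subgroup `K` satisfying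
`d(K) ≥ 4`, and elementary abelian groups of order `32`.

For abelian `G` one has `D(G) = d(G) + 1`, and Olson's theorem computes `d` of a `p`-group. For
nonabelian `G` two constructions give long atoms. First, if `A` is an atom over an abelian subgroup
and `t ∈ A` does not commute with `x`, then adjoining `x` and `t * x⁻¹ * t⁻¹` to `A` gives an atom.
Second, two noncommuting elements of order three which agree modulo a normal subgroup not containing
them yield an atom of length seven. Together with `D(G) ≥ d(G) + 1` this forces `D(G) ≥ 7` unless
`|G|` is `6` or `8`. -/

namespace GroupSequence

/-! ### Product-one and product-one free sequences -/

section Sequences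

variable {α β : Type*} {G H : Type*} [Group G] [Group H]

theorem exists_of_le_add {S A B : Multiset α} (h : S ≤ A + B) :
    ∃ A' ≤ A, ∃ B' ≤ B, A' + B' = S := by
  classical
  exact ⟨S ∩ A, Multiset.inter_le_right, S - A, tsub_le_iff_left.2 h,
    (add_comm _ _).trans (Multiset.sub_add_inter S A)⟩

theorem exists_of_add_eq_cons {S T U : Multiset α} {y : α} (h : T + U = y ::ₘ S) :
    (∃ T', T = y ::ₘ T' ∧ T' + U = S) ∨ ∃ U', U = y ::ₘ U' ∧ T + U' = S := by
  have hy : y ∈ T + U := h ▸ Multiset.mem_cons_self y S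
  rcases Multiset.mem_add.1 hy with hT | hU
  · obtain ⟨T', rfl⟩ := Multiset.exists_cons_of_mem hT
    exact .inl ⟨T', rfl, by simpa using h⟩
  · obtain ⟨U', rfl⟩ := Multiset.exists_cons_of_mem hU
    exact .inr ⟨U', rfl, by simpa using h⟩

theorem exists_of_add_eq_replicate_add_replicate {T U : Multiset α} {a b : α} {m n : ℕ}
    (h : T + U = Multiset.replicate m a + Multiset.replicate n b) :
    ∃ i ≤ m, ∃ j ≤ n, U = Multiset.replicate i a + Multiset.replicate j b ∧
      T = Multiset.replicate (m - i) a + Multiset.replicate (n - j) b := by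
  obtain ⟨A, hA, B, hB, rfl⟩ := exists_of_le_add (h ▸ Multiset.le_add_left U T)
  obtain ⟨i, hi, rfl⟩ := Multiset.le_replicate_iff.1 hA
  obtain ⟨j, hj, rfl⟩ := Multiset.le_replicate_iff.1 hB
  refine ⟨i, hi, j, hj, rfl, add_right_cancel (h.trans ?_)⟩
  rw [add_add_add_comm, ← Multiset.replicate_add, ← Multiset.replicate_add,
    Nat.sub_add_cancel hi, Nat.sub_add_cancel hj]

theorem exists_list_map_eq {f : α → β} {S : Multiset α} {l : List β}
    (h : (l : Multiset β) ≤ S.map f) : ∃ l' : List α, (l' : Multiset α) ≤ S ∧ l'.map f = l := by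
  induction l generalizing S with
  | nil => exact ⟨[], Multiset.zero_le S, rfl⟩
  | cons b l ih =>
    obtain ⟨a, ha, rfl⟩ := Multiset.mem_map.1 (Multiset.mem_of_le h (List.mem_cons_self (a := b)))
    obtain ⟨S, rfl⟩ := Multiset.exists_cons_of_mem ha
    rw [Multiset.map_cons, ← Multiset.cons_coe, Multiset.cons_le_cons_iff] at h
    obtain ⟨l', hl', rfl⟩ := ih h
    exact ⟨a :: l', (Multiset.cons_le_cons_iff a).2 hl', rfl⟩

theorem exists_map_eq_of_le_map {f : α → β} {S : Multiset α} {T : Multiset β} (h : T ≤ S.map f) :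
    ∃ T' ≤ S, T'.map f = T := by
  induction T using Quotient.inductionOn with
  | h l =>
    obtain ⟨l', hl', rfl⟩ := exists_list_map_eq h
    exact ⟨l', hl', Multiset.map_coe f l'⟩

theorem mem_of_mem_map_subtype {K : Subgroup G} {S : Multiset K} {y : G}
    (hy : y ∈ S.map K.subtype) : y ∈ K := by
  obtain ⟨x, -, rfl⟩ := Multiset.mem_map.1 hy
  exact x.2

theorem isProductOne_cons_iff {S : Multiset G} {b : G} :
    IsProductOne (b ::ₘ S) ↔ ∃ l : List G, (l : Multiset G) = S ∧ b * l.prod = 1 := by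
  constructor
  · rintro ⟨l, hl, h1⟩
    obtain ⟨l₁, l₂, rfl⟩ := List.append_of_mem
      (Multiset.mem_coe.1 (hl ▸ Multiset.mem_cons_self b S))
    refine ⟨l₂ ++ l₁, ?_, ?_⟩
    · have hperm : (l₁ ++ b :: l₂).Perm (b :: (l₂ ++ l₁)) :=
        List.perm_middle.trans (List.perm_append_comm.cons b)
      rw [Multiset.coe_eq_coe.2 hperm, ← Multiset.cons_coe] at hl
      exact Multiset.cons_inj_right b |>.1 hl
    · rw [List.prod_append, ← mul_assoc, ← mul_eq_one_comm, ← List.prod_cons, ← List.prod_append]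
      exact h1
  · rintro ⟨l, rfl, h1⟩
    exact ⟨b :: l, rfl, h1⟩

theorem isProductOne_one_cons_iff {S : Multiset G} : IsProductOne (1 ::ₘ S) ↔ IsProductOne S := by
  rw [isProductOne_cons_iff]
  simp only [one_mul]
  rfl

theorem isProductOne_cons_replicate_iff {a b : G} {n : ℕ} :
    IsProductOne (b ::ₘ Multiset.replicate n a) ↔ b * a ^ n = 1 := by
  rw [isProductOne_cons_iff]
  constructor
  · rintro ⟨l, hl, h1⟩
    rw [← Multiset.coe_replicate, Multiset.coe_eq_coe, List.perm_replicate] at hl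
    rwa [hl, List.prod_replicate] at h1
  · intro h
    exact ⟨List.replicate n a, rfl, by rwa [List.prod_replicate]⟩

theorem isProductOne_replicate_iff {a : G} {n : ℕ} :
    IsProductOne (Multiset.replicate n a) ↔ a ^ n = 1 := by
  rw [← isProductOne_one_cons_iff, isProductOne_cons_replicate_iff, one_mul]

theorem not_isProductOne_cons {K : Subgroup G} {S : Multiset G} {b : G} (hS : ∀ y ∈ S, y ∈ K)
    (hb : b ∉ K) : ¬ IsProductOne (b ::ₘ S) := by
  rw [isProductOne_cons_iff]
  rintro ⟨l, rfl, h1⟩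
  rw [eq_inv_of_mul_eq_one_left h1] at hb
  exact hb (K.inv_mem (K.list_prod_mem hS))

theorem IsProductOne.map {S : Multiset G} (h : IsProductOne S) (f : G →* H) :
    IsProductOne (S.map f) := by
  obtain ⟨l, rfl, h1⟩ := h
  exact ⟨l.map f, (Multiset.map_coe f l).symm, by rw [← map_list_prod, h1, map_one]⟩

theorem isProductOne_map_iff (f : G →* H) (hf : Function.Injective f) {S : Multiset G} :
    IsProductOne (S.map f) ↔ IsProductOne S := by
  refine ⟨?_, fun h => h.map f⟩
  rintro ⟨l, hl, h1⟩
  obtain ⟨l', -, rfl⟩ := exists_list_map_eq hl.le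
  refine ⟨l', Multiset.map_injective hf (by simpa using hl), hf ?_⟩
  rw [map_list_prod, h1, map_one]

theorem isProductOneFree_iff {S : Multiset G} :
    IsProductOneFree S ↔ ∀ T ≤ S, IsProductOne T → T = 0 := by
  constructor
  · intro h T hT h1
    by_contra h0
    exact h ⟨T, hT, Multiset.card_pos.2 h0, h1⟩
  · rintro h ⟨T, hT, hcard, h1⟩
    simp [h T hT h1] at hcard

theorem IsProductOneFree.mono {S T : Multiset G} (hS : IsProductOneFree S) (h : T ≤ S) :
    IsProductOneFree T :=
  isProductOneFree_iff.2 fun U hU => isProductOneFree_iff.1 hS U (hU.trans h)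

theorem isProductOneFree_zero : IsProductOneFree (0 : Multiset G) :=
  isProductOneFree_iff.2 fun _ hT _ => Multiset.le_zero.1 hT

theorem isProductOneFree_replicate {a : G} {n : ℕ} (h : n < orderOf a) :
    IsProductOneFree (Multiset.replicate n a) := by
  rw [isProductOneFree_iff]
  intro T hT h1
  obtain ⟨i, hi, rfl⟩ := Multiset.le_replicate_iff.1 hT
  rw [isProductOne_replicate_iff] at h1
  rw [Nat.eq_zero_of_dvd_of_lt (orderOf_dvd_of_pow_eq_one h1) (hi.trans_lt h),
    Multiset.replicate_zero]

theorem IsProductOneFree.map {S : Multiset G} (hS : IsProductOneFree S) (f : G →* H)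
    (hf : Function.Injective f) : IsProductOneFree (S.map f) := by
  rw [isProductOneFree_iff] at *
  intro T hT h1
  obtain ⟨T', hT', rfl⟩ := exists_map_eq_of_le_map hT
  rw [hS T' hT' ((isProductOne_map_iff f hf).1 h1), Multiset.map_zero]

theorem IsProductOneFree.of_map (f : G →* H) {S : Multiset G}
    (hS : IsProductOneFree (S.map f)) : IsProductOneFree S := by
  rw [isProductOneFree_iff] at *
  intro T hT h1
  simpa using hS _ (Multiset.map_le_map hT) (h1.map f)

theorem isProductOneFree_add (f : G →* H) {S T : Multiset G} (hS : IsProductOneFree S)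
    (hker : ∀ x ∈ S, f x = 1) (hT : IsProductOneFree (T.map f)) : IsProductOneFree (S + T) := by
  rw [isProductOneFree_iff] at *
  rintro U hU ⟨l, rfl, h1⟩
  obtain ⟨A, hA, B, hB, hAB⟩ := exists_of_le_add hU
  have hf : ∀ n : ℕ, IsProductOne (Multiset.replicate n 1 + B.map f) → IsProductOne (B.map f) := by
    intro n
    induction n with
    | zero => simp
    | succ n ih =>
      rw [Multiset.replicate_succ, Multiset.cons_add, isProductOne_one_cons_iff]
      exact ih
  have hAmap : A.map f = Multiset.replicate (Multiset.card A) 1 :=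
    Multiset.eq_replicate.2 ⟨Multiset.card_map f A, by
      simpa using fun x hx => hker x (Multiset.mem_of_le hA hx)⟩
  have hBf : IsProductOne (B.map f) := by
    apply hf (Multiset.card A)
    rw [← hAmap, ← Multiset.map_add, hAB]
    exact IsProductOne.map ⟨l, rfl, h1⟩ f
  obtain rfl : B = 0 := by simpa using hT _ (Multiset.map_le_map hB) hBf
  rw [add_zero] at hAB
  exact hS _ (hAB ▸ hA) ⟨l, rfl, h1⟩

theorem IsProductOneFree.cons {K : Subgroup G} {S : Multiset G} {b : G}
    (hS : IsProductOneFree S) (hSK : ∀ y ∈ S, y ∈ K) (hb : b ∉ K) :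
    IsProductOneFree (b ::ₘ S) := by
  rw [isProductOneFree_iff] at *
  intro T hT h1
  by_cases hbT : b ∈ T
  · obtain ⟨T, rfl⟩ := Multiset.exists_cons_of_mem hbT
    have hTS : T ≤ S := (Multiset.cons_le_cons_iff b).1 hT
    exact absurd h1 (not_isProductOne_cons (fun y hy => hSK y (Multiset.mem_of_le hTS hy)) hb)
  · exact hS T ((Multiset.le_cons_of_notMem hbT).1 hT) h1

end Sequences

/-! ### Atoms and the Davenport constants -/

section Davenport

variable {G H : Type*} [Group G] [Group H]

/-- Minimal product-one sequences: nonempty product-one sequences which are not the concatenation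
of two nonempty product-one sequences. These are the atoms of the monoid `𝓑(G)`, described as
plain multisets. -/
def IsMinimalProductOne (S : Multiset G) : Prop :=
  S ≠ 0 ∧ IsProductOne S ∧ ∀ T U, T + U = S → IsProductOne T → IsProductOne U → T = 0 ∨ U = 0

theorem isAddUnit_productOneMonoid_iff {S : productOneMonoid G} :
    IsAddUnit S ↔ (S : Multiset G) = 0 := by
  constructor
  · intro h
    obtain ⟨T, hT⟩ := h.exists_neg
    exact (add_eq_zero.1 (congrArg Subtype.val hT)).1
  · intro h
    rw [show S = 0 from Subtype.ext h]
    exact isAddUnit_zero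

theorem addIrreducible_iff {S : productOneMonoid G} :
    AddIrreducible S ↔ IsMinimalProductOne (S : Multiset G) := by
  constructor
  · intro h
    refine ⟨mt isAddUnit_productOneMonoid_iff.2 h.not_isAddUnit, S.2, fun T U hTU hT hU => ?_⟩
    simpa only [isAddUnit_productOneMonoid_iff] using
      h.isAddUnit_or_isAddUnit (a := ⟨T, hT⟩) (b := ⟨U, hU⟩) (Subtype.ext hTU.symm)
  · rintro ⟨h0, -, h⟩
    refine ⟨mt isAddUnit_productOneMonoid_iff.1 h0, fun T U hTU => ?_⟩
    simpa only [isAddUnit_productOneMonoid_iff] using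
      h T U (congrArg Subtype.val hTU.symm) T.2 U.2

theorem IsMinimalProductOne.map {S : Multiset G} (h : IsMinimalProductOne S) (f : G →* H)
    (hf : Function.Injective f) : IsMinimalProductOne (S.map f) := by
  obtain ⟨h0, h1, h2⟩ := h
  refine ⟨mt Multiset.map_eq_zero.1 h0, h1.map f, fun T U hTU hT hU => ?_⟩
  obtain ⟨T, -, rfl⟩ := exists_map_eq_of_le_map (hTU ▸ Multiset.le_add_right T U)
  obtain ⟨U, -, rfl⟩ := exists_map_eq_of_le_map (hTU ▸ Multiset.le_add_left U _)
  rw [isProductOne_map_iff f hf] at hT hU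
  rw [← Multiset.map_add] at hTU
  simpa only [Multiset.map_eq_zero] using h2 T U (Multiset.map_injective hf hTU) hT hU

theorem IsMinimalProductOne.of_map {S : Multiset G} (f : G →* H) (hf : Function.Injective f)
    (h : IsMinimalProductOne (S.map f)) : IsMinimalProductOne S := by
  obtain ⟨h0, h1, h2⟩ := h
  refine ⟨mt Multiset.map_eq_zero.2 h0, (isProductOne_map_iff f hf).1 h1, fun T U hTU hT hU => ?_⟩
  simpa only [Multiset.map_eq_zero] using
    h2 _ _ (by rw [← Multiset.map_add, hTU]) (hT.map f) (hU.map f)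

theorem IsProductOneFree.isMinimalProductOne {l : List G}
    (hl : IsProductOneFree (l : Multiset G)) :
    IsMinimalProductOne (l.prod⁻¹ ::ₘ (l : Multiset G)) := by
  rw [isProductOneFree_iff] at hl
  refine ⟨Multiset.cons_ne_zero, isProductOne_cons_iff.2 ⟨l, rfl, inv_mul_cancel _⟩,
    fun T U h hT hU => ?_⟩
  rcases exists_of_add_eq_cons h with ⟨T', -, h'⟩ | ⟨U', -, h'⟩
  · exact .inr (hl U (h' ▸ Multiset.le_add_left U T') hU)
  · exact .inl (hl T (h' ▸ Multiset.le_add_right T U') hT)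

theorem natCast_le_biSup_iff {α : Type*} {s : Set α} (hs : s.Nonempty) {f : α → ℕ} {k : ℕ} :
    (k : ℕ∞) ≤ ⨆ x ∈ s, (f x : ℕ∞) ↔ ∃ x ∈ s, k ≤ f x := by
  constructor
  · intro h
    rcases Nat.eq_zero_or_pos k with rfl | hk
    · obtain ⟨x, hx⟩ := hs
      exact ⟨x, hx, Nat.zero_le _⟩
    · have hlt : ((k - 1 : ℕ) : ℕ∞) < ⨆ x ∈ s, (f x : ℕ∞) :=
        lt_of_lt_of_le (by exact_mod_cast Nat.sub_lt hk one_pos) h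
      obtain ⟨x, hx, hfx⟩ := lt_biSup_iff.1 hlt
      exact ⟨x, hx, Nat.le_of_pred_lt (by exact_mod_cast hfx)⟩
  · rintro ⟨x, hx, hk⟩
    exact le_iSup₂_of_le x hx (by exact_mod_cast hk)

theorem IsProductOneFree.card_le {S : Multiset G} (hS : IsProductOneFree S) :
    (Multiset.card S : ℕ∞) ≤ smallDavenport G :=
  le_iSup₂_of_le S hS le_rfl

theorem le_smallDavenport_iff {k : ℕ} :
    (k : ℕ∞) ≤ smallDavenport G ↔ ∃ S : Multiset G, IsProductOneFree S ∧ Multiset.card S = k := by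
  rw [smallDavenport, natCast_le_biSup_iff ⟨0, isProductOneFree_zero⟩]
  constructor
  · rintro ⟨S, hS, hk⟩
    obtain ⟨l, rfl⟩ := Quot.exists_rep S
    exact ⟨(l.take k : List G), hS.mono (List.take_sublist k l).subperm,
      List.length_take_of_le hk⟩
  · rintro ⟨S, hS, rfl⟩
    exact ⟨S, hS, le_rfl⟩

theorem le_largeDavenport_iff {k : ℕ} :
    (k : ℕ∞) ≤ largeDavenport G ↔
      ∃ S : Multiset G, IsMinimalProductOne S ∧ k ≤ Multiset.card S := by
  have hone : IsMinimalProductOne ([].prod⁻¹ ::ₘ ([] : List G) : Multiset G) :=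
    isProductOneFree_zero.isMinimalProductOne
  rw [largeDavenport, natCast_le_biSup_iff (s := {S | AddIrreducible S})
    (f := fun S : productOneMonoid G => Multiset.card (S : Multiset G))
    ⟨⟨_, hone.2.1⟩, addIrreducible_iff.2 hone⟩]
  constructor
  · rintro ⟨S, hS, hk⟩
    exact ⟨S, addIrreducible_iff.1 hS, hk⟩
  · rintro ⟨S, hS, hk⟩
    exact ⟨⟨S, hS.2.1⟩, addIrreducible_iff.2 hS, hk⟩

theorem IsMinimalProductOne.card_le {S : Multiset G} (hS : IsMinimalProductOne S) :
    (Multiset.card S : ℕ∞) ≤ largeDavenport G :=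
  le_largeDavenport_iff.2 ⟨S, hS, le_rfl⟩

theorem smallDavenport_le_of_forall {x : ℕ∞}
    (h : ∀ S : Multiset G, IsProductOneFree S → (Multiset.card S : ℕ∞) ≤ x) :
    smallDavenport G ≤ x :=
  iSup₂_le h

theorem largeDavenport_le_of_forall {x : ℕ∞}
    (h : ∀ S : Multiset G, IsMinimalProductOne S → (Multiset.card S : ℕ∞) ≤ x) :
    largeDavenport G ≤ x :=
  iSup₂_le fun S hS => h S (addIrreducible_iff.1 hS)

theorem finite_setOf_coe_le {α : Type*} (S : Multiset α) :
    {l : List α | (l : Multiset α) ≤ S}.Finite := by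
  classical
  refine ((Set.finite_Iic S).subset ?_).of_finite_fibers ?_
    (f := ((↑) : List α → Multiset α))
  · rintro _ ⟨l, hl, rfl⟩
    exact hl
  · rintro _ ⟨m, -, rfl⟩
    refine m.permutations.finite_toSet.subset ?_
    rintro l ⟨-, hl⟩
    exact List.mem_permutations.2 (Multiset.coe_eq_coe.1 hl)

theorem IsProductOneFree.exists_cons [Infinite G] {S : Multiset G} (hS : IsProductOneFree S) :
    ∃ g, IsProductOneFree (g ::ₘ S) := by
  obtain ⟨g, hg⟩ := ((finite_setOf_coe_le S).image fun l => l.prod⁻¹).exists_notMem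
  refine ⟨g, isProductOneFree_iff.2 fun T hT h1 => ?_⟩
  by_cases hgT : g ∈ T
  · obtain ⟨T, rfl⟩ := Multiset.exists_cons_of_mem hgT
    obtain ⟨l, rfl, hl⟩ := isProductOne_cons_iff.1 h1
    exact absurd ⟨l, (Multiset.cons_le_cons_iff g).1 hT, (eq_inv_of_mul_eq_one_left hl).symm⟩ hg
  · exact isProductOneFree_iff.1 hS T ((Multiset.le_cons_of_notMem hgT).1 hT) h1

theorem smallDavenport_eq_top [Infinite G] : smallDavenport G = ⊤ := by
  refine ENat.eq_top_iff_forall_ge.2 fun n => ?_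
  induction n with
  | zero => exact zero_le
  | succ n ih =>
    obtain ⟨S, hS, rfl⟩ := le_smallDavenport_iff.1 ih
    obtain ⟨g, hg⟩ := hS.exists_cons
    simpa using hg.card_le

theorem finite_of_smallDavenport_le {n : ℕ} (h : smallDavenport G ≤ n) : Finite G := by
  by_contra hG
  rw [not_finite_iff_infinite] at hG
  exact absurd (smallDavenport_eq_top.symm.trans_le h) (by simp)

theorem smallDavenport_le_of_injective (f : G →* H) (hf : Function.Injective f) :
    smallDavenport G ≤ smallDavenport H :=
  smallDavenport_le_of_forall fun S hS => by
    simpa only [Multiset.card_map] using (hS.map f hf).card_le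

theorem largeDavenport_le_of_injective (f : G →* H) (hf : Function.Injective f) :
    largeDavenport G ≤ largeDavenport H :=
  largeDavenport_le_of_forall fun S hS => by
    simpa only [Multiset.card_map] using (hS.map f hf).card_le

theorem smallDavenport_congr (e : G ≃* H) : smallDavenport G = smallDavenport H :=
  le_antisymm (smallDavenport_le_of_injective e.toMonoidHom e.injective)
    (smallDavenport_le_of_injective e.symm.toMonoidHom e.symm.injective)

theorem largeDavenport_congr (e : G ≃* H) : largeDavenport G = largeDavenport H :=
  le_antisymm (largeDavenport_le_of_injective e.toMonoidHom e.injective)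
    (largeDavenport_le_of_injective e.symm.toMonoidHom e.symm.injective)

theorem smallDavenport_subgroup_le (K : Subgroup G) : smallDavenport K ≤ smallDavenport G :=
  smallDavenport_le_of_injective K.subtype K.subtype_injective

theorem smallDavenport_add_smallDavenport_quotient_le (N : Subgroup G) [N.Normal] :
    smallDavenport N + smallDavenport (G ⧸ N) ≤ smallDavenport G := by
  refine ENat.biSup_add_biSup_le ⟨0, isProductOneFree_zero⟩ ⟨0, isProductOneFree_zero⟩
    fun S hS T hT => ?_
  obtain ⟨s, hs⟩ := (QuotientGroup.mk'_surjective N).hasRightInverse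
  have hlift : (T.map s).map (QuotientGroup.mk' N) = T := by
    rw [Multiset.map_map, hs.comp_eq_id, Multiset.map_id]
  have hker : ∀ x ∈ S.map N.subtype, QuotientGroup.mk' N x = 1 := fun x hx =>
    (QuotientGroup.eq_one_iff x).2 (mem_of_mem_map_subtype hx)
  have hfree : IsProductOneFree (S.map N.subtype + T.map s) :=
    isProductOneFree_add _ (hS.map N.subtype N.subtype_injective) hker (hlift.symm ▸ hT)
  simpa only [Multiset.card_add, Multiset.card_map, Nat.cast_add] using hfree.card_le

theorem smallDavenport_add_one_le {K : Subgroup G} (hK : K ≠ ⊤) :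
    smallDavenport K + 1 ≤ smallDavenport G := by
  obtain ⟨b, hb⟩ : ∃ b, b ∉ K := by simpa [Subgroup.eq_top_iff'] using hK
  rw [smallDavenport, ENat.biSup_add ⟨0, isProductOneFree_zero⟩]
  refine iSup₂_le fun S hS => ?_
  have hfree : IsProductOneFree (b ::ₘ S.map K.subtype) :=
    (hS.map K.subtype K.subtype_injective).cons (fun _ => mem_of_mem_map_subtype) hb
  simpa using hfree.card_le

theorem smallDavenport_add_one_le_of_lt {K L : Subgroup G} (h : K < L) :
    smallDavenport K + 1 ≤ smallDavenport L := by
  rw [← smallDavenport_congr (Subgroup.subgroupOfEquivOfLe h.le)]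
  exact smallDavenport_add_one_le (mt Subgroup.subgroupOf_eq_top.1 h.not_ge)

theorem le_smallDavenport_of_lt_orderOf {g : G} {k : ℕ} (h : k < orderOf g) :
    (k : ℕ∞) ≤ smallDavenport G := by
  simpa using (isProductOneFree_replicate h).card_le

theorem le_smallDavenport_zpowers {g : G} {k : ℕ} (h : k < orderOf g) :
    (k : ℕ∞) ≤ smallDavenport (Subgroup.zpowers g) :=
  le_smallDavenport_of_lt_orderOf (g := ⟨g, Subgroup.mem_zpowers g⟩) (by rwa [Subgroup.orderOf_mk])

theorem add_one_le_smallDavenport_of_lt_orderOf {g : G} {k : ℕ} (h : k < orderOf g)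
    (hg : Subgroup.zpowers g ≠ ⊤) : (k : ℕ∞) + 1 ≤ smallDavenport G :=
  (add_le_add_left (le_smallDavenport_zpowers h) 1).trans (smallDavenport_add_one_le hg)

theorem one_le_smallDavenport [Nontrivial G] : 1 ≤ smallDavenport G := by
  obtain ⟨x, hx⟩ := exists_ne (1 : G)
  simpa using (isProductOneFree_zero.cons (K := ⊥) (by simp) hx).card_le

theorem two_le_smallDavenport (h : 3 ≤ Nat.card G) : 2 ≤ smallDavenport G := by
  have : Finite G := Nat.finite_of_card_ne_zero (by lia)
  have : Nontrivial G := Finite.one_lt_card_iff_nontrivial.1 (by lia)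
  obtain ⟨x, hx⟩ := exists_ne (1 : G)
  by_cases ht : Subgroup.zpowers x = ⊤
  · refine le_smallDavenport_of_lt_orderOf (k := 2) (g := x) ?_
    rwa [← Nat.card_zpowers, ht, Subgroup.card_top]
  · have : Nontrivial (Subgroup.zpowers x) :=
      (Subgroup.nontrivial_iff_ne_bot _).2 (mt Subgroup.zpowers_eq_bot.1 hx)
    exact (add_le_add_left one_le_smallDavenport 1).trans (smallDavenport_add_one_le ht)

theorem smallDavenport_add_one_le_largeDavenport : smallDavenport G + 1 ≤ largeDavenport G := by
  rw [smallDavenport, ENat.biSup_add ⟨0, isProductOneFree_zero⟩]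
  refine iSup₂_le fun S hS => ?_
  obtain ⟨l, rfl⟩ := Quot.exists_rep S
  simpa using IsMinimalProductOne.card_le (IsProductOneFree.isMinimalProductOne hS)

theorem exists_prod_eq_one_of_card_lt_length [Finite G] {l : List G} (h : Nat.card G < l.length) :
    ∃ p q r : List G, l = p ++ q ++ r ∧ q ≠ [] ∧ r ≠ [] ∧ q.prod = 1 := by
  have hinj : ¬ Function.Injective (fun i : Fin l.length => (l.take i).prod) := fun hinj =>
    h.not_ge (by simpa using Nat.card_le_card_of_injective _ hinj)
  obtain ⟨i, j, hij, hne⟩ := Function.not_injective_iff.1 hinj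
  wlog hlt : i < j generalizing i j
  · exact this j i hij.symm hne.symm (lt_of_le_of_ne (not_lt.1 hlt) hne.symm)
  have htake : (l.take j).take i = l.take i := by
    rw [List.take_take, min_eq_left (Fin.lt_def.1 hlt).le]
  refine ⟨l.take i, (l.take j).drop i, l.drop j, ?_, ?_, ?_, ?_⟩
  · rw [← htake, List.take_append_drop, List.take_append_drop]
  · simpa [List.drop_eq_nil_iff] using hlt
  · simp
  · have hprod := List.prod_take_mul_prod_drop (l.take j) i
    rwa [htake, show (l.take i).prod = (l.take j).prod from hij, mul_eq_left] at hprod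

theorem largeDavenport_le_card [Finite G] : largeDavenport G ≤ Nat.card G := by
  refine largeDavenport_le_of_forall fun S hS => ?_
  obtain ⟨-, ⟨l, rfl, h1⟩, hmin⟩ := hS
  by_contra! hlt
  obtain ⟨p, q, r, rfl, hq, hr, hq1⟩ :=
    exists_prod_eq_one_of_card_lt_length (l := l) (by exact_mod_cast hlt)
  have hpr : (p ++ r).prod = 1 := by simpa [hq1] using h1
  have hadd : (q : Multiset G) + (p ++ r : List G) = (p ++ q ++ r : List G) := by
    rw [Multiset.coe_add, Multiset.coe_eq_coe, ← List.append_assoc]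
    exact List.perm_append_comm.append_right r
  rcases hmin _ _ hadd ⟨q, rfl, hq1⟩ ⟨_, rfl, hpr⟩ with h | h
  · exact hq ((Multiset.coe_eq_zero q).1 h)
  · exact hr (List.append_eq_nil_iff.1 ((Multiset.coe_eq_zero _).1 h)).2

theorem isProductOne_iff_prod_eq_one {G : Type*} [CommGroup G] {S : Multiset G} :
    IsProductOne S ↔ S.prod = 1 := by
  constructor
  · rintro ⟨l, rfl, h1⟩
    exact h1
  · intro h
    obtain ⟨l, rfl⟩ := Quot.exists_rep S
    exact ⟨l, rfl, h⟩

open scoped IsMulCommutative in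
theorem IsProductOne.of_add [IsMulCommutative G] {S T : Multiset G}
    (hST : IsProductOne (S + T)) (hT : IsProductOne T) : IsProductOne S := by
  rw [isProductOne_iff_prod_eq_one] at *
  rwa [Multiset.prod_add, hT, mul_one] at hST

theorem largeDavenport_le_smallDavenport_add_one [IsMulCommutative G] :
    largeDavenport G ≤ smallDavenport G + 1 := by
  refine largeDavenport_le_of_forall fun S hS => ?_
  obtain ⟨u, hu⟩ := Multiset.exists_mem_of_ne_zero hS.1
  obtain ⟨A, rfl⟩ := Multiset.exists_cons_of_mem hu
  have hA : IsProductOneFree A := isProductOneFree_iff.2 fun T hT hT1 => by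
    obtain ⟨R, rfl⟩ := Multiset.le_iff_exists_add.1 hT
    have hadd : (u ::ₘ R) + T = u ::ₘ (T + R) := by rw [Multiset.cons_add, add_comm R]
    exact (hS.2.2 _ _ hadd (IsProductOne.of_add (hadd ▸ hS.2.1) hT1) hT1).resolve_left
      Multiset.cons_ne_zero
  simpa using hA.card_le

theorem largeDavenport_eq_smallDavenport_add_one [IsMulCommutative G] :
    largeDavenport G = smallDavenport G + 1 :=
  le_antisymm largeDavenport_le_smallDavenport_add_one smallDavenport_add_one_le_largeDavenport

theorem IsMinimalProductOne.card_le_of_commute {S : Multiset G} (hS : IsMinimalProductOne S)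
    (hcomm : ∀ a ∈ S, ∀ b ∈ S, a * b = b * a) :
    (Multiset.card S : ℕ∞) ≤ smallDavenport G + 1 := by
  obtain ⟨K, hK, hSK⟩ : ∃ K : Subgroup G, IsMulCommutative K ∧ ∀ x ∈ S, x ∈ K :=
    ⟨Subgroup.closure {x | x ∈ S}, Subgroup.isMulCommutative_closure hcomm,
      fun x hx => Subgroup.subset_closure hx⟩
  lift S to Multiset K using hSK
  rw [Multiset.card_map]
  have hSK : (Multiset.card S : ℕ∞) ≤ largeDavenport K :=
    (IsMinimalProductOne.of_map K.subtype K.subtype_injective hS).card_le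
  exact hSK.trans <| largeDavenport_le_smallDavenport_add_one.trans <|
    add_le_add_left (smallDavenport_subgroup_le K) 1

end Davenport

/-! ### Long atoms -/

section Atoms

variable {G H : Type*} [Group G] [Group H]

theorem isMinimalProductOne_cons {S : Multiset G} {v : G} (h1 : IsProductOne (v ::ₘ S))
    (h : ∀ T U, T + U = S → IsProductOne (v ::ₘ T) → IsProductOne U → U = 0) :
    IsMinimalProductOne (v ::ₘ S) := by
  refine ⟨Multiset.cons_ne_zero, h1, fun T U hTU hT hU => ?_⟩
  rcases exists_of_add_eq_cons hTU with ⟨T', rfl, h'⟩ | ⟨U', rfl, h'⟩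
  · exact .inr (h T' U h' hT hU)
  · exact .inl (h U' T ((add_comm _ _).trans h') hU hT)

theorem IsMinimalProductOne.cons_cons_map_subtype {K : Subgroup G} [IsMulCommutative K]
    {A : Multiset K} (hA : IsMinimalProductOne A) {t : K} (ht : t ∈ A) {x : G}
    (hx : ¬ Commute x t) :
    IsMinimalProductOne ((t : G) * x⁻¹ * (t : G)⁻¹ ::ₘ x ::ₘ A.map K.subtype) := by
  set y : G := (t : G) * x⁻¹ * (t : G)⁻¹ with hy
  have hxK : x ∉ K := fun h => hx (congrArg Subtype.val (mul_comm' (⟨x, h⟩ : K) t))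
  have hyK : y ∉ K := by
    rwa [hy, K.mul_mem_cancel_right (K.inv_mem t.2), K.mul_mem_cancel_left t.2, K.inv_mem_iff]
  have hyx : y * x ≠ 1 := by
    intro h
    rw [hy, mul_assoc, mul_assoc, mul_eq_one_iff_inv_eq, eq_inv_mul_iff_mul_eq,
      eq_inv_mul_iff_mul_eq, ← mul_assoc, mul_inv_eq_iff_eq_mul] at h
    exact hx h.symm
  obtain ⟨R, rfl⟩ := Multiset.exists_cons_of_mem ht
  refine isMinimalProductOne_cons ?_ fun T U h hT hU => ?_
  · have hmap := hA.2.1.map K.subtype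
    rw [Multiset.map_cons] at hmap ⊢
    obtain ⟨l, hl, h1⟩ := isProductOne_cons_iff.1 hmap
    refine isProductOne_cons_iff.2 ⟨t :: x :: l, ?_, ?_⟩
    · rw [← hl, Multiset.cons_swap]
      rfl
    · simpa [hy, mul_assoc] using h1
  rcases exists_of_add_eq_cons h with ⟨T', rfl, h'⟩ | ⟨U', rfl, h'⟩
  · obtain ⟨T, -, rfl⟩ := exists_map_eq_of_le_map (h' ▸ Multiset.le_add_right T' U)
    obtain ⟨U, -, rfl⟩ := exists_map_eq_of_le_map (h' ▸ Multiset.le_add_left U _)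
    rw [← Multiset.map_add] at h'
    have hTU := Multiset.map_injective K.subtype_injective h'
    rw [isProductOne_map_iff _ K.subtype_injective] at hU
    have hT1 : IsProductOne T := IsProductOne.of_add (hTU ▸ hA.2.1) hU
    refine Multiset.map_eq_zero.2 ((hA.2.2 T U hTU hT1 hU).resolve_left ?_)
    rintro rfl
    exact hyx (by simpa using (isProductOne_cons_replicate_iff (b := y) (a := x) (n := 1)).1 hT)
  · refine absurd hT (not_isProductOne_cons (fun z hz => ?_) hyK)
    exact mem_of_mem_map_subtype (h' ▸ Multiset.mem_add.2 (.inl hz))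

theorem add_three_le_largeDavenport [Finite G] {K : Subgroup G} [IsMulCommutative K] {k : ℕ}
    (hk : k ≤ smallDavenport K) (hZ : Nat.card (Subgroup.center G) ≤ k) :
    k + 3 ≤ largeDavenport G := by
  obtain ⟨S, hS, rfl⟩ := le_smallDavenport_iff.1 hk
  obtain ⟨t, ht, htZ⟩ : ∃ t ∈ S, (t : G) ∉ Subgroup.center G := by
    by_contra! hall
    have hSZ : ∀ y ∈ S.map K.subtype, y ∈ Subgroup.center G := by simpa using hall
    have hfree := hS.map K.subtype K.subtype_injective
    have hcard := Multiset.card_map K.subtype S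
    lift S.map K.subtype to Multiset (Subgroup.center G) using hSZ with S' hS'
    have hle := (IsProductOneFree.of_map (Subgroup.center G).subtype hfree).card_le
    have hlt := (add_le_add_left hle 1).trans
      (smallDavenport_add_one_le_largeDavenport.trans largeDavenport_le_card)
    rw [Multiset.card_map] at hcard
    norm_cast at hlt
    lia
  obtain ⟨x, hx⟩ : ∃ x : G, ¬ Commute x t := by
    simpa only [Subgroup.mem_center_iff, not_forall, commute_iff_eq] using htZ
  obtain ⟨l, rfl⟩ := Quot.exists_rep S
  have := (IsMinimalProductOne.cons_cons_map_subtype (IsProductOneFree.isMinimalProductOne hS)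
    (Multiset.mem_cons_of_mem ht) hx).card_le
  simpa [add_assoc] using this

theorem orderOf_dvd_card {f : G →* H} {S : Multiset G} {c : H} (hS : ∀ y ∈ S, f y = c)
    (h : IsProductOne S) : orderOf c ∣ Multiset.card S := by
  have hmap : S.map f = Multiset.replicate (Multiset.card S) c :=
    Multiset.eq_replicate.2 ⟨Multiset.card_map f S, by simpa using hS⟩
  have h1 := h.map f
  rw [hmap, isProductOne_replicate_iff] at h1
  exact orderOf_dvd_of_pow_eq_one h1

theorem isMinimalProductOne_cons_replicate_three {g k v : G} (hg : g ^ 3 = 1) (hk : k ^ 3 = 1)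
    (hne : g ≠ k) (hv : v ≠ 1)
    (h1 : IsProductOne (v ::ₘ (Multiset.replicate 3 g + Multiset.replicate 3 k)))
    (hdvd : ∀ i j, IsProductOne (Multiset.replicate i g + Multiset.replicate j k) → 3 ∣ i + j) :
    IsMinimalProductOne (v ::ₘ (Multiset.replicate 3 g + Multiset.replicate 3 k)) := by
  have hgg : g ^ 2 = g⁻¹ := eq_inv_of_mul_eq_one_left (by rw [← pow_succ, hg])
  have hkk : k ^ 2 = k⁻¹ := eq_inv_of_mul_eq_one_left (by rw [← pow_succ, hk])
  refine isMinimalProductOne_cons h1 fun T U h hT hU => ?_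
  obtain ⟨i, hi, j, hj, rfl, rfl⟩ := exists_of_add_eq_replicate_add_replicate h
  have hij := hdvd i j hU
  interval_cases i <;> interval_cases j <;> try lia
  · rfl
  · rw [tsub_self, Multiset.replicate_zero, add_zero, isProductOne_cons_replicate_iff, hg,
      mul_one] at hT
    exact absurd hT hv
  · rw [Multiset.replicate_one, Multiset.singleton_add, isProductOne_cons_replicate_iff, hkk,
      mul_inv_eq_one] at hU
    exact absurd hU hne
  · rw [Multiset.replicate_one, add_comm, Multiset.singleton_add,
      isProductOne_cons_replicate_iff, hgg, mul_inv_eq_one] at hU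
    exact absurd hU.symm hne
  · rw [tsub_self, Multiset.replicate_zero, zero_add, isProductOne_cons_replicate_iff, hk,
      mul_one] at hT
    exact absurd hT hv
  · rw [tsub_self, Multiset.replicate_zero k, add_zero, isProductOne_cons_replicate_iff,
      pow_zero, mul_one] at hT
    exact absurd hT hv

theorem seven_le_largeDavenport_of_pow_three_eq_one {N : Subgroup G} [N.Normal] {g k : G}
    (hg : g ^ 3 = 1) (hk : k ^ 3 = 1) (hgN : g ∉ N) (hgk : g⁻¹ * k ∈ N) (hc : ¬ Commute g k) :
    7 ≤ largeDavenport G := by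
  set v := (g * g * k * g * k * k)⁻¹ with hv
  have hne : g ≠ k := fun h => hc (h ▸ Commute.refl g)
  have hv1 : v ≠ 1 := by
    have hgg : g ^ 2 = g⁻¹ := eq_inv_of_mul_eq_one_left (by rw [← pow_succ, hg])
    have hkk : k ^ 2 = k⁻¹ := eq_inv_of_mul_eq_one_left (by rw [← pow_succ, hk])
    intro h
    rw [hv, inv_eq_one, mul_assoc _ k k, ← pow_two, ← pow_two, hkk, hgg, mul_inv_eq_one, mul_assoc,
      inv_mul_eq_iff_eq_mul] at h
    exact hc h.symm
  have hord : orderOf (g : G ⧸ N) = 3 := by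
    refine orderOf_eq_prime ?_ ?_
    · rw [← QuotientGroup.mk_pow, hg, QuotientGroup.mk_one]
    · rwa [Ne, QuotientGroup.eq_one_iff]
  have hdvd (i j : ℕ) (h : IsProductOne (Multiset.replicate i g + Multiset.replicate j k)) :
      3 ∣ i + j := by
    rw [← hord]
    refine (orderOf_dvd_card (f := QuotientGroup.mk' N) (fun y hy => ?_) h).trans (by simp)
    rcases Multiset.mem_add.1 hy with hy | hy
    · rw [Multiset.eq_of_mem_replicate hy]
      rfl
    · rw [Multiset.eq_of_mem_replicate hy]
      exact (QuotientGroup.eq.2 hgk).symm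
  have h1 : IsProductOne (v ::ₘ (Multiset.replicate 3 g + Multiset.replicate 3 k)) := by
    refine isProductOne_cons_iff.2 ⟨[g, g, k, g, k, k], ?_, by simp [hv, mul_assoc]⟩
    simp only [Multiset.replicate_succ, Multiset.replicate_zero, ← Multiset.cons_coe,
      Multiset.coe_nil, ← Multiset.singleton_add]
    abel
  simpa using (isMinimalProductOne_cons_replicate_three hg hk hne hv1 h1 hdvd).card_le

theorem isMinimalProductOne_cons_cons_replicate_four {r x : G} (hr : orderOf r = 3)
    (hx : x ^ 2 = 1) (hxr : x ∉ Subgroup.zpowers r)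
    (h1 : IsProductOne (x ::ₘ x ::ₘ Multiset.replicate 4 r)) :
    IsMinimalProductOne (x ::ₘ x ::ₘ Multiset.replicate 4 r) := by
  refine isMinimalProductOne_cons h1 fun T U h hT hU => ?_
  rcases exists_of_add_eq_cons h with ⟨T', rfl, h'⟩ | ⟨U', rfl, h'⟩
  · obtain ⟨i, -, rfl⟩ := Multiset.le_replicate_iff.1 (h' ▸ Multiset.le_add_right T' U)
    obtain ⟨j, -, rfl⟩ := Multiset.le_replicate_iff.1 (h' ▸ Multiset.le_add_left U _)
    have hij : i + j = 4 := by simpa using congrArg Multiset.card h'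
    have hj : 3 ∣ j := hr ▸ orderOf_dvd_of_pow_eq_one (isProductOne_replicate_iff.1 hU)
    by_cases hj0 : j = 0
    · rw [hj0, Multiset.replicate_zero]
    · obtain rfl : i = 1 := by lia
      have hxx : IsProductOne (r ::ₘ Multiset.replicate 2 x) := by
        convert hT using 1
        simp only [Multiset.replicate_succ, Multiset.replicate_zero, ← Multiset.singleton_add]
        abel
      rw [isProductOne_cons_replicate_iff, hx, mul_one] at hxx
      simp [hxx] at hr
  · refine absurd hU (not_isProductOne_cons (fun y hy => ?_) hxr)
    rw [Multiset.eq_of_mem_replicate (Multiset.mem_of_le (h' ▸ Multiset.le_add_left U' T) hy)]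
    exact Subgroup.mem_zpowers r

theorem six_le_largeDavenport_of_mul_mul_eq_inv {r x : G} (hr : r ^ 3 = 1) (hr1 : r ≠ 1)
    (hx : x ^ 2 = 1) (hxr : x * r * x = r⁻¹) : 6 ≤ largeDavenport G := by
  have hord : orderOf r = 3 := orderOf_eq_prime hr hr1
  have hmem : x ∉ Subgroup.zpowers r := by
    rintro ⟨j, rfl⟩
    have hc : Commute (r ^ j) r := (Commute.refl r).zpow_left j
    beta_reduce at hx hxr
    rw [hc.eq, mul_assoc, ← pow_two, hx, mul_one, eq_inv_iff_mul_eq_one, ← pow_two] at hxr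
    exact absurd (hord ▸ orderOf_dvd_of_pow_eq_one hxr) (by norm_num)
  have h1 : IsProductOne (x ::ₘ x ::ₘ Multiset.replicate 4 r) := by
    refine isProductOne_cons_iff.2 ⟨[r, r, x, r, r], ?_, ?_⟩
    · simp only [Multiset.replicate_succ, Multiset.replicate_zero, ← Multiset.cons_coe,
        Multiset.coe_nil, ← Multiset.singleton_add]
      abel
    · have hx' : x * x = 1 := by rw [← pow_two, hx]
      have hxrr : x * r * r * x = r⁻¹ * r⁻¹ := by
        rw [← hxr]
        simp only [mul_assoc]
        rw [← mul_assoc x x, hx', one_mul]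
      simp only [List.prod_cons, List.prod_nil, mul_one, ← mul_assoc]
      rw [hxrr]
      group
  simpa using (isMinimalProductOne_cons_cons_replicate_four hord hx hmem h1).card_le

theorem mul_le_smallDavenport_of_commute [Finite G] {x y : G} (hxy : Commute x y)
    (hcop : (orderOf x).Coprime (orderOf y)) (hG : Nat.card G ≠ orderOf x * orderOf y) :
    ((orderOf x * orderOf y : ℕ) : ℕ∞) ≤ smallDavenport G := by
  have hord : orderOf (x * y) = orderOf x * orderOf y :=
    hxy.orderOf_mul_eq_mul_orderOf_of_coprime hcop
  have htop : Subgroup.zpowers (x * y) ≠ ⊤ := fun h => hG <| by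
    rw [← hord, ← Nat.card_zpowers, h, Subgroup.card_top]
  have hpos : 0 < orderOf (x * y) := orderOf_pos _
  convert add_one_le_smallDavenport_of_lt_orderOf (Nat.sub_lt hpos one_pos) htop
  rw [← hord]
  exact_mod_cast (Nat.sub_add_cancel hpos).symm

theorem exists_orderOf_eq_two_of_isPGroup {N : Subgroup G} (hN : IsPGroup 2 N) {v : G}
    (hv : v ∈ N) (hv1 : v ≠ 1) : ∃ n : ℕ, orderOf (v ^ n) = 2 := by
  obtain ⟨m, hm⟩ := (IsPGroup.iff_orderOf.1 hN) ⟨v, hv⟩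
  rw [Subgroup.orderOf_mk] at hm
  have hm0 : m ≠ 0 := by
    rintro rfl
    exact hv1 (orderOf_eq_one_iff.1 (hm.trans (pow_zero 2)))
  exact ⟨_, orderOf_pow_orderOf_div (by simp [hm]) (hm ▸ dvd_pow_self 2 hm0)⟩

theorem seven_le_largeDavenport_of_normal_two_group [Finite G] {N : Subgroup G} [N.Normal]
    (hN : IsPGroup 2 N) (hbot : N ≠ ⊥) {x : G} (hx : orderOf x = 3) (hG : Nat.card G ≠ 6) :
    7 ≤ largeDavenport G := by
  by_cases hfix : ∃ v ∈ N, v ≠ 1 ∧ Commute x v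
  · obtain ⟨v, hv, hv1, hxv⟩ := hfix
    obtain ⟨n, hn⟩ := exists_orderOf_eq_two_of_isPGroup hN hv hv1
    have hd := mul_le_smallDavenport_of_commute (hxv.pow_right n) (by rw [hx, hn]; decide)
      (by rwa [hx, hn])
    rw [hx, hn] at hd
    exact (add_le_add_left hd 1).trans smallDavenport_add_one_le_largeDavenport
  push Not at hfix
  have hx3 : x ^ 3 = 1 := hx ▸ pow_orderOf_eq_one x
  have hx1 : x ≠ 1 := fun h => by simp [h] at hx
  have hxN : x ∉ N := fun h => hfix x h hx1 (Commute.refl x)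
  obtain ⟨a, ha, ha1⟩ := N.bot_or_exists_ne_one.resolve_left hbot
  have hw : x⁻¹ * (a * x * a⁻¹) ∈ N := by
    have hconj : x⁻¹ * a * x ∈ N := by simpa using ‹N.Normal›.conj_mem a ha x⁻¹
    simpa [mul_assoc] using N.mul_mem hconj (N.inv_mem ha)
  refine seven_le_largeDavenport_of_pow_three_eq_one hx3 ?_ hxN hw fun hc => ?_
  · rw [conj_pow, hx3, mul_one, mul_inv_cancel]
  · have hw1 : x⁻¹ * (a * x * a⁻¹) = 1 := by
      by_contra hne
      exact hfix _ hw hne ((Commute.refl x).inv_right.mul_right hc)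
    rw [inv_mul_eq_one, eq_mul_inv_iff_mul_eq] at hw1
    exact hfix a ha ha1 hw1

end Atoms

/-! ### Orders of groups with small Davenport constants -/

section Orders

variable {G : Type*} [Group G]

theorem exists_mem_center_orderOf_eq [Finite G] [Nontrivial G] {p : ℕ} [Fact p.Prime]
    (hG : IsPGroup p G) : ∃ z ∈ Subgroup.center G, orderOf z = p := by
  have := hG.center_nontrivial
  obtain ⟨n, hn⟩ := IsPGroup.iff_card.1 (hG.to_subgroup (Subgroup.center G))
  have hn0 : n ≠ 0 := by
    rintro rfl
    exact Finite.one_lt_card.ne' hn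
  obtain ⟨z, hz⟩ := exists_prime_orderOf_dvd_card' p (hn ▸ dvd_pow_self p hn0)
  exact ⟨z, z.2, by rwa [Subgroup.orderOf_coe]⟩

theorem zpowers_normal_of_mem_center {z : G} (hz : z ∈ Subgroup.center G) :
    (Subgroup.zpowers z).Normal where
  conj_mem n hn g := by
    have hnZ := (Subgroup.zpowers_le.2 hz) hn
    rwa [Subgroup.mem_center_iff.1 hnZ g, mul_inv_cancel_right]

open scoped commutatorElement in
theorem commutator_le_of_sq_mem {N : Subgroup G} (hN : ∀ g : G, g ^ 2 ∈ N) :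
    commutator G ≤ N := by
  refine Subgroup.commutator_le.2 fun a _ b _ => ?_
  have h : ⁅a, b⁆ = (a * b) ^ 2 * (b⁻¹ * a⁻¹ * b) ^ 2 * b⁻¹ ^ 2 := by
    simp only [commutatorElement_def, pow_two]
    group
  exact h ▸ N.mul_mem (N.mul_mem (hN _) (hN _)) (hN _)

theorem isMulCommutative_of_sq_eq_one (h : ∀ g : G, g ^ 2 = 1) : IsMulCommutative G := by
  rw [← commutator_eq_bot_iff, eq_bot_iff]
  exact commutator_le_of_sq_mem fun g => Subgroup.mem_bot.2 (h g)

theorem card_le_card_centralizer_mul_card_commutator [Finite G] (a : G) :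
    Nat.card G ≤ Nat.card (Subgroup.centralizer {a}) * Nat.card (commutator G) := by
  rw [← (Subgroup.centralizer {a}).card_mul_index, Subgroup.index_eq_card]
  refine Nat.mul_le_mul_left _ ((Finite.card_le_of_embedding
    (Subgroup.quotientCentralizerEmbedding a)).trans ?_)
  exact Nat.card_mono (Set.toFinite _) (commutator_eq_closure G ▸ Subgroup.subset_closure)

theorem mul_pred_le_smallDavenport_of_card_eq_prime_pow {p : ℕ} [hp : Fact p.Prime]
    {n : ℕ} (h : Nat.card G = p ^ n) : ((n * (p - 1) : ℕ) : ℕ∞) ≤ smallDavenport G := by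
  induction n generalizing G with
  | zero => simp
  | succ n ih =>
    have : Finite G := Nat.finite_of_card_ne_zero (h ▸ pow_ne_zero _ hp.out.ne_zero)
    have : Nontrivial G :=
      Finite.one_lt_card_iff_nontrivial.1 (h ▸ Nat.one_lt_pow n.succ_ne_zero hp.out.one_lt)
    obtain ⟨z, hz, hzp⟩ := exists_mem_center_orderOf_eq (IsPGroup.of_card h)
    have := zpowers_normal_of_mem_center hz
    have hcard : Nat.card (G ⧸ Subgroup.zpowers z) = p ^ n := by
      have hmul := (Subgroup.zpowers z).card_eq_card_quotient_mul_card_subgroup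
      rw [h, Nat.card_zpowers, hzp, pow_succ] at hmul
      exact (Nat.eq_of_mul_eq_mul_right hp.out.pos hmul).symm
    have hle := (add_le_add (le_smallDavenport_zpowers (g := z) (k := p - 1)
      (by rw [hzp]; exact Nat.sub_lt hp.out.pos one_pos)) (ih hcard)).trans
      (smallDavenport_add_smallDavenport_quotient_le _)
    rwa [add_mul, one_mul, add_comm, Nat.cast_add]

theorem smallDavenport_add_le_of_card_eq_prime_pow [Finite G] {p : ℕ} [hp : Fact p.Prime]
    {K : Subgroup G} {m j : ℕ} (hK : Nat.card K = p ^ m) (hG : Nat.card G = p ^ (m + j)) :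
    smallDavenport K + j ≤ smallDavenport G := by
  induction j generalizing K m with
  | zero => simpa using smallDavenport_subgroup_le K
  | succ j ih =>
    obtain ⟨L, hL, hKL⟩ := Sylow.exists_subgroup_card_pow_succ (p := p) (n := m)
      (hG ▸ pow_dvd_pow p (by lia)) hK
    have hne : K ≠ L := by
      rintro rfl
      exact absurd (Nat.pow_right_injective hp.out.two_le (hK.symm.trans hL)) (by lia)
    calc smallDavenport K + (j + 1 : ℕ) = smallDavenport K + 1 + j := by push_cast; ring
      _ ≤ smallDavenport L + j :=
        add_le_add_left (smallDavenport_add_one_le_of_lt (lt_of_le_of_ne hKL hne)) _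
      _ ≤ smallDavenport G := ih hL (by rw [hG]; congr 1; lia)

theorem card_le_two_mul_card_sylow [Finite G] {p : ℕ} [Fact p.Prime] (P : Sylow p G)
    [IsMulCommutative (P : Subgroup G)] (hP : smallDavenport G < smallDavenport P + 2) :
    Nat.card G ≤ 2 * Nat.card P := by
  by_cases hnormal : (P : Subgroup G).Normal
  · rw [(P : Subgroup G).card_eq_card_quotient_mul_card_subgroup]
    refine Nat.mul_le_mul_right _ ?_
    by_contra! h
    exact hP.not_ge ((add_le_add_right (two_le_smallDavenport h) _).trans
      (smallDavenport_add_smallDavenport_quotient_le _))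
  have hnorm : Subgroup.normalizer ((P : Subgroup G) : Set G) = P := by
    by_contra hne
    refine hP.not_ge (le_trans ?_
      (smallDavenport_add_one_le (mt Subgroup.normalizer_eq_top_iff.1 hnormal)))
    rw [← one_add_one_eq_two, ← add_assoc]
    exact add_le_add_left (smallDavenport_add_one_le_of_lt
      (lt_of_le_of_ne Subgroup.le_normalizer (Ne.symm hne))) 1
  have hcompl := MonoidHom.ker_transferSylow_isComplement' P
    (hnorm.trans_le (Subgroup.le_centralizer _))
  rw [← hcompl.card_mul_card]
  refine Nat.mul_le_mul_right _ ?_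
  by_contra! h
  refine hP.not_ge (le_trans ?_ (smallDavenport_add_smallDavenport_quotient_le
    (MonoidHom.transferSylow P (hnorm.trans_le (Subgroup.le_centralizer _))).ker))
  rw [smallDavenport_congr hcompl.symm.QuotientMulEquiv, add_comm]
  exact add_le_add_left (two_le_smallDavenport h) _

theorem exists_normal_of_card_eq_three_mul {a : ℕ} (h : Nat.card G = 3 * 2 ^ a) :
    ∃ N : Subgroup G, N.Normal ∧ (Nat.card N = 2 ^ a ∨ Nat.card N * 2 = 2 ^ a) := by
  have : Finite G := Nat.finite_of_card_ne_zero (by simp [h])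
  obtain ⟨P, hP⟩ := Sylow.exists_subgroup_card_pow_prime (G := G) 2 (n := a)
    (h ▸ Dvd.intro_left 3 rfl)
  have hidx : P.index = 3 := by
    have := P.card_mul_index
    rw [hP, h, mul_comm] at this
    exact Nat.eq_of_mul_eq_mul_right (pow_pos two_pos a) this
  refine ⟨P.normalCore, P.normalCore_normal, ?_⟩
  have hdvd : P.normalCore.index ∣ 3 * 2 := by
    change P.normalCore.index ∣ Nat.factorial 3
    rw [← hidx, Subgroup.normalCore_eq_ker, Subgroup.index_ker, Subgroup.index_eq_card,
      ← Nat.card_perm]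
    exact Subgroup.card_subgroup_dvd_card (MulAction.toPermHom G (G ⧸ P)).range
  obtain ⟨c, hc⟩ := hidx ▸ Subgroup.index_dvd_of_le P.normalCore_le
  have hmul := P.normalCore.card_mul_index
  rw [h, hc] at hmul
  rw [hc] at hdvd
  rcases (Nat.dvd_prime Nat.prime_two).1 (Nat.dvd_of_mul_dvd_mul_left three_pos hdvd) with
    rfl | rfl
  · exact .inl (by lia)
  · exact .inr (by lia)

theorem add_two_le_smallDavenport_of_card_eq_three_mul {a : ℕ}
    (h : Nat.card G = 3 * 2 ^ a) : (a : ℕ∞) + 2 ≤ smallDavenport G := by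
  have : Finite G := Nat.finite_of_card_ne_zero (by simp [h])
  obtain ⟨N, hN, hcard⟩ := exists_normal_of_card_eq_three_mul h
  have hle := smallDavenport_add_smallDavenport_quotient_le N
  have hmul := N.card_eq_card_quotient_mul_card_subgroup
  rw [h] at hmul
  rcases hcard with hcard | hcard
  · have hd := mul_pred_le_smallDavenport_of_card_eq_prime_pow hcard
    rw [Nat.add_one_sub_one, mul_one] at hd
    rw [hcard] at hmul
    have hquot := Nat.eq_of_mul_eq_mul_right (pow_pos two_pos a) hmul
    exact (add_le_add hd (two_le_smallDavenport hquot.le)).trans hle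
  · cases a with
    | zero => lia
    | succ a =>
      have hd := mul_pred_le_smallDavenport_of_card_eq_prime_pow (p := 2) (n := a)
        (by rw [pow_succ] at hcard; lia : Nat.card N = 2 ^ a)
      rw [Nat.add_one_sub_one, mul_one] at hd
      have hquot : Nat.card (G ⧸ N) = 6 := by
        refine Nat.eq_of_mul_eq_mul_right (Nat.card_pos (α := N)) ?_
        rw [← hmul, ← hcard]
        ring
      obtain ⟨x, hx⟩ := exists_prime_orderOf_dvd_card' (G := G ⧸ N) 3 (by rw [hquot]; norm_num)
      have htop : Subgroup.zpowers x ≠ ⊤ := fun ht => by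
        have := Nat.card_zpowers x
        rw [ht, Subgroup.card_top, hquot, hx] at this
        lia
      refine le_trans (le_of_eq ?_) ((add_le_add hd
        (add_one_le_smallDavenport_of_lt_orderOf (k := 2) (by lia) htop)).trans hle)
      norm_cast

theorem seven_le_largeDavenport_of_card_eq_three_mul {a : ℕ} (ha : 2 ≤ a)
    (h : Nat.card G = 3 * 2 ^ a) : 7 ≤ largeDavenport G := by
  have : Finite G := Nat.finite_of_card_ne_zero (by simp [h])
  obtain ⟨N, hN, hcard⟩ := exists_normal_of_card_eq_three_mul h
  obtain ⟨x, hx⟩ := exists_prime_orderOf_dvd_card' (G := G) 3 (h ▸ Dvd.intro _ rfl)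
  have hfour : 2 ^ 2 ≤ 2 ^ a := Nat.pow_le_pow_right two_pos ha
  have hpgroup : IsPGroup 2 N := by
    obtain ⟨k, -, hk⟩ := (Nat.dvd_prime_pow Nat.prime_two).1
      (hcard.elim (fun h => h.dvd) fun h => Dvd.intro 2 h : Nat.card N ∣ 2 ^ a)
    exact IsPGroup.of_card hk
  refine seven_le_largeDavenport_of_normal_two_group hpgroup ?_ hx (by lia)
  rintro rfl
  rw [Subgroup.card_bot] at hcard
  lia

theorem sq_eq_one_of_smallDavenport_le {n : ℕ} (h : Nat.card G = 2 ^ n)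
    (hd : smallDavenport G ≤ n) (x : G) : x ^ 2 = 1 := by
  have : Finite G := Nat.finite_of_card_ne_zero (by simp [h])
  obtain ⟨j, hjn, hj⟩ := (Nat.dvd_prime_pow Nat.prime_two).1
    (h ▸ orderOf_dvd_natCard x : orderOf x ∣ 2 ^ n)
  suffices 2 ^ j ∣ 2 ^ 1 from orderOf_dvd_iff_pow_eq_one.1 (hj ▸ this)
  rw [Nat.pow_dvd_pow_iff_le_right one_lt_two]
  by_contra! hlt
  have hle := (add_le_add_left (le_smallDavenport_zpowers (g := x) (k := 2 ^ j - 1)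
    (by rw [hj]; exact Nat.sub_lt (by positivity) one_pos)) _).trans
    ((smallDavenport_add_le_of_card_eq_prime_pow (p := 2) (K := Subgroup.zpowers x) (m := j)
      (j := n - j) (by rw [Nat.card_zpowers, hj])
      (by rw [h, Nat.add_sub_cancel' hjn])).trans hd)
  have hexp : j + 2 ≤ 2 ^ j := by
    obtain ⟨i, rfl⟩ := Nat.exists_eq_add_of_lt hlt
    have := Nat.lt_two_pow_self (n := i)
    simp only [pow_add]
    lia
  norm_cast at hle
  lia

theorem card_sylow_eq_of_pow_dvd {p k : ℕ} [hp : Fact p.Prime] (P : Sylow p G)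
    (hdvd : p ^ k ∣ Nat.card G) (hd : smallDavenport G < ((k + 1) * (p - 1) : ℕ)) :
    Nat.card P = p ^ k := by
  have : Finite G := finite_of_smallDavenport_le hd.le
  have hle := (mul_pred_le_smallDavenport_of_card_eq_prime_pow P.card_eq_multiplicity).trans
    (smallDavenport_subgroup_le _)
  have hlt := Nat.lt_of_mul_lt_mul_right (by exact_mod_cast hle.trans_lt hd)
  rw [P.card_eq_multiplicity]
  congr 1
  exact le_antisymm (Nat.le_of_lt_succ hlt)
    ((hp.out.pow_dvd_iff_le_factorization Nat.card_pos.ne').1 hdvd)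

theorem eq_two_pow_or_eq_three_mul_two_pow {n : ℕ} (hn : n ≠ 0)
    (h : ∀ p, p.Prime → p ∣ n → p = 2 ∨ p = 3) (h9 : ¬ 3 ^ 2 ∣ n) :
    ∃ a, n = 2 ^ a ∨ n = 3 * 2 ^ a := by
  by_cases h3 : 3 ∣ n
  · obtain ⟨m, rfl⟩ := h3
    refine ⟨_, .inr (congrArg (3 * ·) (Nat.eq_prime_pow_of_unique_prime_dvd (p := 2)
      (right_ne_zero_of_mul hn) fun {q} hq hqm => ?_))⟩
    refine (h q hq (hqm.mul_left 3)).resolve_right ?_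
    rintro rfl
    exact h9 (by rw [pow_two]; exact mul_dvd_mul_left 3 hqm)
  · refine ⟨_, .inl (Nat.eq_prime_pow_of_unique_prime_dvd (p := 2) hn fun {q} hq hqn => ?_)⟩
    refine (h q hq hqn).resolve_right ?_
    rintro rfl
    exact h3 hqn

theorem exists_isMulCommutative_of_pow_dvd {p k : ℕ} [Fact p.Prime]
    (hk : k = 1 ∨ k = 2) (hfour : k * (p - 1) = 4) (hdvd : p ^ k ∣ Nat.card G)
    (hd : smallDavenport G < ((k + 1) * (p - 1) : ℕ)) (hd5 : smallDavenport G ≤ 5) :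
    ∃ K : Subgroup G, IsMulCommutative K ∧ 4 ≤ smallDavenport K ∧ Nat.card G ≤ 2 * p ^ k := by
  have : Finite G := finite_of_smallDavenport_le hd5
  have P : Sylow p G := default
  have hP := card_sylow_eq_of_pow_dvd P hdvd hd
  have hcomm : IsMulCommutative (P : Subgroup G) := by
    rcases hk with rfl | rfl
    · have := isCyclic_of_prime_card (hP.trans (pow_one p))
      infer_instance
    · exact IsPGroup.isMulCommutative_of_card_eq_prime_sq hP
  have hdP : 4 ≤ smallDavenport P := by
    simpa [hfour] using mul_pred_le_smallDavenport_of_card_eq_prime_pow hP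
  refine ⟨P, hcomm, hdP, hP ▸ card_le_two_mul_card_sylow P (hd5.trans_lt ?_)⟩
  exact lt_of_lt_of_le (by norm_num) (add_le_add_left hdP 2)

theorem eq_two_or_three_or_five_of_prime_dvd_card (hd : smallDavenport G ≤ 5) {p : ℕ}
    (hp : p.Prime) (hpG : p ∣ Nat.card G) : p = 2 ∨ p = 3 ∨ p = 5 := by
  have : Finite G := finite_of_smallDavenport_le hd
  have : Fact p.Prime := ⟨hp⟩
  obtain ⟨g, hg⟩ := exists_prime_orderOf_dvd_card' p hpG
  have hle : p - 1 ≤ 5 := by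
    exact_mod_cast (le_smallDavenport_of_lt_orderOf (g := g)
      (by rw [hg]; exact Nat.sub_lt hp.pos one_pos)).trans hd
  have hp6 : p ≤ 6 := by lia
  interval_cases p <;> revert hp <;> decide

theorem card_of_smallDavenport_le_five (hd : smallDavenport G ≤ 5) :
    (∃ a ≤ 4, Nat.card G = 2 ^ a) ∨ (∃ a ≤ 3, Nat.card G = 3 * 2 ^ a) ∨
      (∃ K : Subgroup G, IsMulCommutative K ∧ 4 ≤ smallDavenport K ∧ Nat.card G ≤ 18) ∨
      (Nat.card G = 32 ∧ ∀ x : G, x ^ 2 = 1) := by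
  have : Finite G := finite_of_smallDavenport_le hd
  have : Fact (Nat.Prime 5) := ⟨Nat.prime_five⟩
  by_cases h5 : 5 ^ 1 ∣ Nat.card G
  · obtain ⟨K, hK, hdK, hcard⟩ := exists_isMulCommutative_of_pow_dvd (.inl rfl) rfl h5
      (hd.trans_lt (by norm_num)) hd
    exact .inr (.inr (.inl ⟨K, hK, hdK, by lia⟩))
  by_cases h9 : 3 ^ 2 ∣ Nat.card G
  · obtain ⟨K, hK, hdK, hcard⟩ := exists_isMulCommutative_of_pow_dvd (.inr rfl) rfl h9
      (hd.trans_lt (by norm_num)) hd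
    exact .inr (.inr (.inl ⟨K, hK, hdK, by lia⟩))
  obtain ⟨a, ha | ha⟩ := eq_two_pow_or_eq_three_mul_two_pow Nat.card_pos.ne' (fun p hp hpG => by
    rcases eq_two_or_three_or_five_of_prime_dvd_card hd hp hpG with rfl | rfl | rfl
    · exact .inl rfl
    · exact .inr rfl
    · exact absurd ((pow_one 5).symm ▸ hpG) h5) h9
  · have hda := (mul_pred_le_smallDavenport_of_card_eq_prime_pow ha).trans hd
    have ha5 : a ≤ 5 := by
      rw [Nat.add_one_sub_one, mul_one] at hda
      exact_mod_cast hda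
    rcases ha5.lt_or_eq with hlt | rfl
    · exact .inl ⟨a, by lia, ha⟩
    · exact .inr (.inr (.inr ⟨ha, sq_eq_one_of_smallDavenport_le ha hd⟩))
  · have hda : a + 2 ≤ 5 := by
      exact_mod_cast (add_two_le_smallDavenport_of_card_eq_three_mul ha).trans hd
    exact .inr (.inl ⟨a, by lia, ha⟩)

theorem four_mul_card_center_le [Finite G] (hG : ¬ IsMulCommutative G) :
    4 * Nat.card (Subgroup.center G) ≤ Nat.card G := by
  rw [(Subgroup.center G).card_eq_card_quotient_mul_card_subgroup]
  refine Nat.mul_le_mul_right _ ?_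
  by_contra! h
  have hcyclic : IsCyclic (G ⧸ Subgroup.center G) := by
    have hpos : 0 < Nat.card (G ⧸ Subgroup.center G) := Nat.card_pos
    obtain h | h | h : Nat.card (G ⧸ Subgroup.center G) = 1 ∨
        Nat.card (G ⧸ Subgroup.center G) = 2 ∨ Nat.card (G ⧸ Subgroup.center G) = 3 := by lia
    · have := (Nat.card_eq_one_iff_unique.1 h).1
      infer_instance
    · exact isCyclic_of_prime_card h
    · exact isCyclic_of_prime_card h
  exact hG (MonoidHom.isMulCommutative_of_isCyclic_of_ker_le_center
    (QuotientGroup.mk' (Subgroup.center G)) (by simp))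

theorem seven_le_largeDavenport_of_four_le_smallDavenport [Finite G] (hG : ¬ IsMulCommutative G)
    (hcard : Nat.card G < 20) {K : Subgroup G} [IsMulCommutative K]
    (hK : 4 ≤ smallDavenport K) : 7 ≤ largeDavenport G :=
  add_three_le_largeDavenport (k := 4) hK (by have := four_mul_card_center_le hG; lia)

theorem exists_orderOf_eq_four (hG : ¬ IsMulCommutative G) (h4 : ∀ g : G, g ^ 4 = 1) :
    ∃ g : G, orderOf g = 4 := by
  by_contra! h
  refine hG (isMulCommutative_of_sq_eq_one fun g => ?_)
  by_contra hg
  exact h g (orderOf_eq_prime_pow (p := 2) (n := 1) (by simpa using hg) (h4 g))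

theorem exists_pow_eq_of_mem_zpowers {a y : G} (ha : IsOfFinOrder a)
    (h : y ∈ Subgroup.zpowers a) : ∃ k < orderOf a, a ^ k = y := by
  classical
  simpa using ha.mem_zpowers_iff_mem_range_orderOf.1 h

/- Otherwise every cyclic subgroup of order four is its own centralizer, so it contains the center,
and all squares lie in the subgroup of order two generated by a central involution. Conjugacy
classes then have at most two elements, and the centralizer of an element of order four at least
`|G| / 2`. -/
theorem exists_commute_notMem_zpowers (hG : ¬ IsMulCommutative G)
    (h4 : ∀ g : G, g ^ 4 = 1) (hcard : 8 < Nat.card G) :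
    ∃ a c : G, orderOf a = 4 ∧ Commute a c ∧ c ∉ Subgroup.zpowers a := by
  have : Finite G := Nat.finite_of_card_ne_zero (by lia)
  by_contra! hex
  have : Nontrivial G := Finite.one_lt_card_iff_nontrivial.1 (by lia)
  obtain ⟨z, hz, hz2⟩ := exists_mem_center_orderOf_eq
    (IsPGroup.of_exponent_dvd_pow (p := 2) (n := 2) (Monoid.exponent_dvd_of_forall_pow_eq_one h4))
  have hsq (g : G) : g ^ 2 ∈ Subgroup.zpowers z := by
    by_cases hg : g ^ 2 = 1
    · exact hg ▸ one_mem _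
    have hg4 : orderOf g = 4 := orderOf_eq_prime_pow (p := 2) (n := 1) (by simpa using hg) (h4 g)
    have hzg : z ∈ Subgroup.zpowers g := hex g z hg4 (Subgroup.mem_center_iff.1 hz g)
    obtain ⟨k, hk, rfl⟩ := exists_pow_eq_of_mem_zpowers (isOfFinOrder_of_finite g) hzg
    rw [orderOf_pow, hg4] at hz2
    rw [hg4] at hk
    obtain rfl : k = 2 := by interval_cases k <;> simp_all
    exact Subgroup.mem_zpowers _
  obtain ⟨a, ha⟩ := exists_orderOf_eq_four hG h4
  have hcent : Nat.card (Subgroup.centralizer {a}) ≤ 4 := by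
    rw [← ha, ← Nat.card_zpowers]
    exact Subgroup.card_le_of_le fun c hc =>
      hex a c ha (Subgroup.mem_centralizer_singleton_iff.1 hc).symm
  have hcomm : Nat.card (commutator G) ≤ 2 := by
    rw [← hz2, ← Nat.card_zpowers]
    exact Subgroup.card_le_of_le (commutator_le_of_sq_mem hsq)
  have := card_le_card_centralizer_mul_card_commutator a
  have := Nat.mul_le_mul hcent hcomm
  lia

theorem seven_le_largeDavenport_of_card_eq_sixteen (hG : ¬ IsMulCommutative G)
    (hcard : Nat.card G = 16) : 7 ≤ largeDavenport G := by
  have : Finite G := Nat.finite_of_card_ne_zero (by lia)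
  by_cases h4 : ∀ g : G, g ^ 4 = 1
  · obtain ⟨a, c, ha, hac, hc⟩ := exists_commute_notMem_zpowers hG h4 (by lia)
    set K : Subgroup G := Subgroup.closure {a, c}
    have hK : IsMulCommutative K := by
      refine Subgroup.isMulCommutative_closure ?_
      rintro x (rfl | rfl) y (rfl | rfl)
      exacts [rfl, hac, hac.symm, rfl]
    have hlt : Subgroup.zpowers a < K := by
      refine SetLike.lt_iff_le_and_exists.2 ⟨?_, c, Subgroup.subset_closure (by simp), hc⟩
      exact Subgroup.zpowers_le.2 (Subgroup.subset_closure (by simp))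
    refine seven_le_largeDavenport_of_four_le_smallDavenport hG (by lia) (K := K) ?_
    exact (add_le_add_left (le_smallDavenport_zpowers (g := a) (k := 3) (by lia)) 1).trans
      (smallDavenport_add_one_le_of_lt hlt)
  · push Not at h4
    obtain ⟨g, hg⟩ := h4
    obtain ⟨j, -, hj⟩ := (Nat.dvd_prime_pow Nat.prime_two (m := 4)).1
      (hcard ▸ orderOf_dvd_natCard g : orderOf g ∣ 16)
    have hj3 : 3 ≤ j := by
      by_contra! hlt
      refine hg (orderOf_dvd_iff_pow_eq_one.1 (hj ▸ ?_))
      exact pow_dvd_pow 2 (by lia : j ≤ 2)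
    have h8 := Nat.pow_le_pow_right two_pos hj3
    exact (add_le_add_left (le_smallDavenport_of_lt_orderOf (g := g) (k := 6) (by lia)) 1).trans
      smallDavenport_add_one_le_largeDavenport

end Orders

/-! ### Abelian `p`-groups -/

theorem sum_pow_eq_zero {R ι : Type*} [CommSemiring R] (s : Finset ι) {x : ι → R} {n : ι → ℕ}
    (h : ∀ i, x i ^ (n i + 1) = 0) : (∑ i ∈ s, x i) ^ (∑ i ∈ s, n i + 1) = 0 := by
  classical
  induction s using Finset.induction_on with
  | empty => simp
  | insert i s hi ih =>
    rw [Finset.sum_insert hi, Finset.sum_insert hi]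
    exact (Commute.all _ _).add_pow_eq_zero_of_add_le_succ_of_pow_eq_zero (h i) ih (by lia)

theorem of_sub_one_mem_of_mem_closure {R G : Type*} [CommRing R] [CommGroup G]
    {J : Ideal (MonoidAlgebra R G)} {s : Set G} (h : ∀ x ∈ s, MonoidAlgebra.of R G x - 1 ∈ J)
    {x : G} (hx : x ∈ Subgroup.closure s) : MonoidAlgebra.of R G x - 1 ∈ J := by
  let f := (Ideal.Quotient.mk J).toMonoidHom.comp (MonoidAlgebra.of R G)
  have hs : Set.EqOn f (1 : G →* MonoidAlgebra R G ⧸ J) s :=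
    fun y hy => Ideal.Quotient.eq.2 (h y hy)
  exact Ideal.Quotient.eq.1 (MonoidHom.eqOn_closure hs hx)

theorem coeff_one_prod_one_sub_of {R G : Type*} [CommRing R] [CommGroup G] {S : Multiset G}
    (hS : IsProductOneFree S) : (S.map fun x => 1 - MonoidAlgebra.of R G x).prod.coeff 1 = 1 := by
  classical
  rw [isProductOneFree_iff] at hS
  have hne : ∀ t : Finset S, t ≠ ∅ → ∏ i ∈ t, (i : G) ≠ 1 := fun t ht h1 => by
    have hle : t.val.map (fun i : S => (i : G)) ≤ S := by
      conv_rhs => rw [← Multiset.map_univ_coe S]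
      exact Multiset.map_le_map (Finset.val_le_iff.2 t.subset_univ)
    exact ht (by simpa using hS _ hle (isProductOne_iff_prod_eq_one.2 h1))
  have hexpand : (S.map fun x => 1 - MonoidAlgebra.of R G x).prod =
      ∑ t : Finset S, (-1) ^ t.card * MonoidAlgebra.of R G (∏ i ∈ t, (i : G)) := by
    rw [← Multiset.map_univ S, Finset.prod_map_val]
    simp only [sub_eq_add_neg, Finset.prod_one_add, Finset.prod_neg, map_prod,
      Finset.powerset_univ]
  rw [hexpand, MonoidAlgebra.coeff_sum, Finsupp.finsetSum_apply,
    Finset.sum_eq_single_of_mem ∅ (Finset.mem_univ ∅)]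
  · simp
  · intro t _ ht
    rcases neg_one_pow_eq_or (MonoidAlgebra R G) t.card with h | h <;>
      simp [h, Finsupp.single_eq_of_ne (hne t ht).symm]

/- **Olson's bound.** The augmentation ideal of `ZMod p[G]` is generated by the elements `g i - 1`,
whose `p ^ e i`-th powers vanish, so a product of too many factors `1 - x` is zero. Over a
product-one free sequence its coefficient at `1` is `1`. -/
theorem smallDavenport_le_of_closure_range_eq_top {p : ℕ} [Fact p.Prime] {G ι : Type*}
    [CommGroup G] [Fintype ι] {g : ι → G} {e : ι → ℕ} (hg : ∀ i, g i ^ p ^ e i = 1)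
    (hcl : Subgroup.closure (Set.range g) = ⊤) :
    smallDavenport G ≤ (∑ i, (p ^ e i - 1) : ℕ) := by
  refine smallDavenport_le_of_forall fun S hS => ?_
  by_contra! hlt
  let X : G →* MonoidAlgebra (ZMod p) G := MonoidAlgebra.of (ZMod p) G
  have : CharP (MonoidAlgebra (ZMod p) G) p := charP_of_injective_algebraMap' (ZMod p) p
  let J : Ideal (MonoidAlgebra (ZMod p) G) := ∑ i, Ideal.span {X (g i) - 1}
  have hJ0 : J ^ Multiset.card S = 0 := by
    refine pow_eq_zero_of_le (by exact_mod_cast hlt)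
      (sum_pow_eq_zero Finset.univ (n := fun i => p ^ e i - 1) fun i => ?_)
    rw [Nat.sub_add_cancel (Nat.one_le_pow _ _ (Fact.out : p.Prime).pos),
      Ideal.span_singleton_pow, sub_pow_char_pow, one_pow, ← map_pow, hg i, map_one, sub_self,
      Ideal.span_singleton_zero, Ideal.zero_eq_bot]
  have hmem : ∀ x : G, X x - 1 ∈ J := fun x => by
    refine of_sub_one_mem_of_mem_closure (s := Set.range g) ?_ (hcl ▸ Subgroup.mem_top x)
    rintro _ ⟨i, rfl⟩
    have hle : Ideal.span {X (g i) - 1} ≤ J :=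
      Finset.single_le_sum (f := fun i => Ideal.span {X (g i) - 1}) (fun _ _ => zero_le)
        (Finset.mem_univ i)
    exact hle (Ideal.mem_span_singleton_self _)
  have hprod : ∀ T : Multiset G, (T.map fun x => 1 - X x).prod ∈ J ^ Multiset.card T := by
    intro T
    induction T using Multiset.induction_on with
    | empty => simp
    | cons x T ih =>
      rw [Multiset.map_cons, Multiset.prod_cons, Multiset.card_cons, pow_succ']
      exact Ideal.mul_mem_mul (by simpa using J.neg_mem (hmem x)) ih
  have h0 : (S.map fun x => 1 - X x).prod = 0 := by simpa [hJ0] using hprod S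
  have h1 := coeff_one_prod_one_sub_of (R := ZMod p) hS
  rw [show (S.map fun x => 1 - MonoidAlgebra.of (ZMod p) G x).prod = 0 from h0] at h1
  simp at h1

theorem sum_le_smallDavenport_pi {ι : Type*} [Fintype ι] {G : ι → Type*} [∀ i, Group (G i)]
    {k : ι → ℕ} (h : ∀ i, (k i : ℕ∞) ≤ smallDavenport (G i)) :
    ((∑ i, k i : ℕ) : ℕ∞) ≤ smallDavenport (∀ i, G i) := by
  classical
  choose S hS hk using fun i => le_smallDavenport_iff.1 (h i)
  have hfree : ∀ s : Finset ι,
      IsProductOneFree (∑ i ∈ s, (S i).map (MonoidHom.mulSingle G i)) := by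
    intro s
    induction s using Finset.induction_on with
    | empty => exact isProductOneFree_zero
    | insert j s hj ih =>
      rw [Finset.sum_insert hj, add_comm]
      refine isProductOneFree_add (Pi.evalMonoidHom G j) ih (fun x hx => ?_) ?_
      · obtain ⟨i, hi, hx⟩ := Multiset.mem_sum.1 hx
        obtain ⟨y, -, rfl⟩ := Multiset.mem_map.1 hx
        exact Pi.mulSingle_eq_of_ne (by rintro rfl; exact hj hi) y
      · simpa [Multiset.map_map, Function.comp_def] using hS j
  simpa [hk] using (hfree Finset.univ).card_le

theorem closure_range_mulSingle_ofAdd_one {ι : Type*} [Finite ι] [DecidableEq ι] (n : ι → ℕ) :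
    Subgroup.closure (Set.range fun i : ι =>
      (Pi.mulSingle i (Multiplicative.ofAdd 1) : ∀ i, C (n i))) = ⊤ := by
  have := Fintype.ofFinite ι
  rw [Subgroup.eq_top_iff']
  intro x
  rw [← Finset.univ_prod_mulSingle x]
  refine Subgroup.prod_mem _ fun i _ => ?_
  obtain ⟨k, hk⟩ := ZMod.intCast_surjective (x i).toAdd
  have hpow : x i = Multiplicative.ofAdd 1 ^ k := by
    rw [← ofAdd_zsmul, zsmul_one, hk, ofAdd_toAdd]
  rw [hpow, Pi.mulSingle_zpow]
  exact Subgroup.zpow_mem _ (Subgroup.subset_closure (Set.mem_range_self i)) _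

theorem orderOf_ofAdd_one (n : ℕ) : orderOf (Multiplicative.ofAdd 1 : C n) = n := by
  rw [orderOf_ofAdd_eq_addOrderOf, ZMod.addOrderOf_one]

theorem smallDavenport_pi_C {p : ℕ} [Fact p.Prime] {ι : Type*} [Fintype ι] (e : ι → ℕ) :
    smallDavenport (∀ i, C (p ^ e i)) = (∑ i, (p ^ e i - 1) : ℕ) := by
  classical
  refine le_antisymm
    (smallDavenport_le_of_closure_range_eq_top (fun i => ?_)
      (closure_range_mulSingle_ofAdd_one fun i => p ^ e i))
    (sum_le_smallDavenport_pi fun i =>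
      le_smallDavenport_of_lt_orderOf (g := Multiplicative.ofAdd 1) ?_)
  · rw [← orderOf_dvd_iff_pow_eq_one, orderOf_piMulSingle, orderOf_ofAdd_one]
  · rw [orderOf_ofAdd_one]
    exact Nat.sub_lt (pow_pos (Fact.out : p.Prime).pos _) one_pos

open scoped IsMulCommutative in
theorem exists_mulEquiv_pi_C_of_card_eq_prime_pow {p n : ℕ} [Fact p.Prime] {G : Type*} [Group G]
    [IsMulCommutative G] (h : Nat.card G = p ^ n) :
    ∃ (ι : Type) (_ : Fintype ι) (e : ι → ℕ), (∀ i, e i ≠ 0) ∧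
      Nonempty (G ≃* ∀ i, C (p ^ e i)) := by
  have : Finite G := Nat.finite_of_card_ne_zero (h ▸ pow_ne_zero _ (Fact.out : p.Prime).ne_zero)
  obtain ⟨ι, hι, m, hm, ⟨φ⟩⟩ := CommGroup.equiv_prod_multiplicative_zmod_of_finite G
  have hpow : ∀ i, ∃ e, m i = p ^ e := fun i => by
    have hdvd : m i ∣ p ^ n := by
      rw [← h, Nat.card_congr φ.toEquiv, Nat.card_pi, ← Nat.card_zmod (m i)]
      exact Finset.dvd_prod_of_mem (fun i => Nat.card (C (m i))) (Finset.mem_univ i)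
    obtain ⟨e, -, he⟩ := (Nat.dvd_prime_pow Fact.out).1 hdvd
    exact ⟨e, he⟩
  choose e he using hpow
  obtain rfl : m = fun i => p ^ e i := funext he
  exact ⟨ι, hι, e, fun i h0 => by simpa [h0] using hm i, ⟨φ⟩⟩

theorem nonempty_mulEquiv_pi_of_pow_eq_one {p r : ℕ} [Fact p.Prime] {G : Type*} [Group G]
    [IsMulCommutative G] (hexp : ∀ x : G, x ^ p = 1) (hcard : Nat.card G = p ^ r) :
    Nonempty (G ≃* (Fin r → C p)) := by
  classical
  obtain ⟨ι, _, e, he, ⟨φ⟩⟩ := exists_mulEquiv_pi_C_of_card_eq_prime_pow hcard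
  have he1 : ∀ i, e i = 1 := fun i => by
    have hdvd : p ^ e i ∣ p ^ 1 := by
      rw [pow_one, ← orderOf_ofAdd_one (p ^ e i), ← orderOf_piMulSingle (M := fun i => C (p ^ e i)),
        ← φ.symm.orderOf_eq]
      exact orderOf_dvd_of_pow_eq_one (hexp _)
    exact le_antisymm ((Nat.pow_dvd_pow_iff_le_right (Fact.out : p.Prime).one_lt).1 hdvd)
      (Nat.one_le_iff_ne_zero.2 (he i))
  obtain rfl : e = fun _ => 1 := funext he1
  have hι : Fintype.card ι = r := by
    rw [Nat.card_congr φ.toEquiv, Nat.card_fun, pow_one, Nat.card_eq_fintype_card (α := ι)] at hcard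
    exact Nat.pow_right_injective (Fact.out : p.Prime).two_le (by simpa using hcard)
  exact ⟨φ.trans (MulEquiv.arrowCongr (Fintype.equivFinOfCardEq hι)
    (AddEquiv.toMultiplicative (ZMod.ringEquivCongr (pow_one p)).toAddEquiv))⟩

theorem smallDavenport_of_pow_eq_one {p r : ℕ} [Fact p.Prime] {G : Type*} [Group G]
    [IsMulCommutative G] (hexp : ∀ x : G, x ^ p = 1) (hcard : Nat.card G = p ^ r) :
    smallDavenport G = (r * (p - 1) : ℕ) := by
  obtain ⟨φ⟩ := nonempty_mulEquiv_pi_of_pow_eq_one hexp hcard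
  have hpi := smallDavenport_pi_C (p := p) fun _ : Fin r => 1
  beta_reduce at hpi
  rw [pow_one] at hpi
  rw [smallDavenport_congr φ, hpi, Finset.sum_const, Finset.card_univ, Fintype.card_fin,
    smul_eq_mul]

/-! ### Groups of order eight -/

theorem eq_of_mem_of_card_eq_two {G : Type*} [Group G] {N : Subgroup G} (hN : Nat.card N = 2)
    {u v : G} (hu : u ∈ N) (hv : v ∈ N) (hu1 : u ≠ 1) (hv1 : v ≠ 1) : u = v := by
  obtain ⟨w, -, hw⟩ := (Nat.card_eq_two_iff' (1 : N)).1 hN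
  have huv := (hw ⟨u, hu⟩ (by simpa [Subtype.ext_iff] using hu1)).trans
    (hw ⟨v, hv⟩ (by simpa [Subtype.ext_iff] using hv1)).symm
  exact congrArg Subtype.val huv

theorem exists_prod_mem_of_not_isProductOneFree_map {G : Type*} [Group G] {N : Subgroup G}
    [N.Normal] {R : Multiset G} (h : ¬ IsProductOneFree (R.map (QuotientGroup.mk' N))) :
    ∃ l : List G, (l : Multiset G) ≤ R ∧ l ≠ [] ∧ l.prod ∈ N := by
  simp only [isProductOneFree_iff, not_forall] at h
  obtain ⟨_, hT, ⟨t, rfl, ht⟩, ht0⟩ := h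
  obtain ⟨l, hl, rfl⟩ := exists_list_map_eq hT
  refine ⟨l, hl, by rintro rfl; exact ht0 rfl, ?_⟩
  rwa [← map_list_prod, QuotientGroup.mk'_apply, QuotientGroup.eq_one_iff] at ht

theorem exists_pair_le_of_index_lt_card {G : Type*} [Group G] [Finite G] (N : Subgroup G)
    {S : Multiset G} (h : N.index < Multiset.card S) :
    ∃ a b, {a, b} ≤ S ∧ (a : G ⧸ N) = b := by
  have hdup : ¬ (S.map ((↑) : G → G ⧸ N)).Nodup := fun hnd => by
    classical
    have := Fintype.ofFinite (G ⧸ N)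
    refine h.not_ge ?_
    simpa [Subgroup.index] using
      Finset.card_le_univ (⟨S.map ((↑) : G → G ⧸ N), hnd⟩ : Finset (G ⧸ N))
  rw [Multiset.nodup_iff_le] at hdup
  push Not at hdup
  obtain ⟨q, hq⟩ := hdup
  obtain ⟨l, hl, hlq⟩ := exists_list_map_eq (l := [q, q]) hq
  obtain ⟨a, b, rfl⟩ : ∃ a b, l = [a, b] := by
    rw [← List.length_eq_two, ← List.length_map ((↑) : G → G ⧸ N), hlq]
    rfl
  have hab : (a : G ⧸ N) = q ∧ (b : G ⧸ N) = q := by simpa using hlq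
  exact ⟨a, b, hl, hab.1.trans hab.2.symm⟩

theorem smallDavenport_le_max_of_sq_mem {G : Type*} [Group G] [Finite G] {N : Subgroup G}
    [N.Normal] (hN : Nat.card N = 2) (hsq : ∀ g : G, g ^ 2 ∈ N) :
    smallDavenport G ≤ max (N.index : ℕ∞) (smallDavenport (G ⧸ N) + 2) := by
  refine smallDavenport_le_of_forall fun S hS => ?_
  by_contra! hlt
  obtain ⟨hlt1, hlt2⟩ := max_lt_iff.1 hlt
  obtain ⟨a, b, hab, hq⟩ := exists_pair_le_of_index_lt_card N (by exact_mod_cast hlt1)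
  have habN : a * b ∈ N := by
    rw [← QuotientGroup.eq_one_iff, QuotientGroup.mk_mul, hq, ← QuotientGroup.mk_mul, ← pow_two]
    exact (QuotientGroup.eq_one_iff _).2 (hsq b)
  obtain ⟨R, rfl⟩ := Multiset.le_iff_exists_add.1 hab
  have hR : ¬ IsProductOneFree (R.map (QuotientGroup.mk' N)) := fun h => by
    refine hlt2.not_ge ?_
    rw [Multiset.card_add, Multiset.card_pair, add_comm, Nat.cast_add, Nat.cast_ofNat]
    simpa only [Multiset.card_map] using add_le_add_left h.card_le 2
  obtain ⟨m, hm, hm0, hmN⟩ := exists_prod_mem_of_not_isProductOneFree_map hR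
  rw [isProductOneFree_iff] at hS
  have hab1 : a * b ≠ 1 := fun h1 =>
    absurd (hS {a, b} hab ⟨[a, b], rfl, by simpa using h1⟩) (by simp)
  have hm1 : m.prod ≠ 1 := fun h1 =>
    hm0 (by simpa using hS m (hm.trans (Multiset.le_add_left _ _)) ⟨m, rfl, h1⟩)
  have hprod : a * b * m.prod = 1 := mul_eq_one_iff_eq_inv.2 <|
    eq_of_mem_of_card_eq_two hN habN (inv_mem hmN) hab1 (inv_ne_one.2 hm1)
  refine absurd (hS ({a, b} + m) (add_le_add_right hm _) ⟨a :: b :: m, rfl, ?_⟩) (by simp)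
  rw [List.prod_cons, List.prod_cons, ← mul_assoc, hprod]

theorem prod_mul_inv_prod_mem_commutator {G : Type*} [Group G] {l m : List G} (h : l.Perm m) :
    l.prod * m.prod⁻¹ ∈ commutator G := by
  rw [← Abelianization.ker_of, MonoidHom.mem_ker, map_mul, map_inv, map_list_prod, map_list_prod,
    (h.map _).prod_eq, mul_inv_cancel]

theorem exists_eq_cons_cons_of_not_commute {G : Type*} [Group G] {S : Multiset G}
    (h : ¬ ∀ a ∈ S, ∀ b ∈ S, a * b = b * a) :
    ∃ a b R, S = a ::ₘ b ::ₘ R ∧ a * b ≠ b * a := by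
  push Not at h
  obtain ⟨a, ha, b, hb, hab⟩ := h
  obtain ⟨R, rfl⟩ := Multiset.exists_cons_of_mem ha
  obtain ⟨R, rfl⟩ := Multiset.exists_cons_of_mem <|
    (Multiset.mem_cons.1 hb).resolve_left (by rintro rfl; exact hab rfl)
  exact ⟨a, b, R, rfl, hab⟩

/- Let `r` list the terms of `R`. The products `a * b * r.prod` and `b * a * r.prod` are distinct
elements of the commutator subgroup, which has order two, so one of them is `1`. -/
theorem isProductOne_cons_cons_of_add {G : Type*} [Group G] (hG : Nat.card (commutator G) = 2)
    {a b : G} (hab : a * b ≠ b * a) {T R : Multiset G} (hT : IsProductOne T)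
    (h : IsProductOne (a ::ₘ b ::ₘ (T + R))) : IsProductOne (a ::ₘ b ::ₘ R) := by
  obtain ⟨t, rfl, ht⟩ := hT
  obtain ⟨s, hs, hs1⟩ := h
  obtain ⟨r, rfl⟩ : ∃ r : List G, (r : Multiset G) = R := Quot.exists_rep R
  have hmem : ∀ u : List G, u.Perm [a, b] → u.prod * r.prod ∈ commutator G := fun u hu => by
    have hperm : (u ++ t ++ r).Perm s := Multiset.coe_eq_coe.1 <| by
      rw [hs, ← Multiset.coe_add, ← Multiset.coe_add, Multiset.coe_eq_coe.2 hu]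
      rfl
    simpa [hs1, ht, mul_assoc] using prod_mul_inv_prod_mem_commutator hperm
  have h1 : a * b * r.prod ∈ commutator G := by simpa using hmem [a, b] (List.Perm.refl _)
  have h2 : b * a * r.prod ∈ commutator G := by simpa using hmem [b, a] (List.Perm.swap ..)
  by_contra hne
  have hne1 : a * b * r.prod ≠ 1 := fun h => hne ⟨a :: b :: r, rfl, by simpa [mul_assoc] using h⟩
  have hne2 : b * a * r.prod ≠ 1 := fun h =>
    hne ⟨b :: a :: r, Multiset.cons_swap b a r, by simpa [mul_assoc] using h⟩
  exact hab (mul_right_cancel (eq_of_mem_of_card_eq_two hG h1 h2 hne1 hne2))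

theorem largeDavenport_le_smallDavenport_add_two {G : Type*} [Group G]
    (hG : Nat.card (commutator G) = 2) : largeDavenport G ≤ smallDavenport G + 2 := by
  refine largeDavenport_le_of_forall fun S hS => ?_
  by_cases hcomm : ∀ a ∈ S, ∀ b ∈ S, a * b = b * a
  · exact (hS.card_le_of_commute hcomm).trans (add_le_add_right (by norm_num) _)
  obtain ⟨a, b, R, rfl, hab⟩ := exists_eq_cons_cons_of_not_commute hcomm
  have hR : IsProductOneFree R := isProductOneFree_iff.2 fun T hTR hT => by
    obtain ⟨U, rfl⟩ := Multiset.le_iff_exists_add.1 hTR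
    exact (hS.2.2 (a ::ₘ b ::ₘ U) T (by simp [add_comm U])
      (isProductOne_cons_cons_of_add hG hab hT hS.2.1) hT).resolve_left Multiset.cons_ne_zero
  simpa [add_assoc, one_add_one_eq_two] using add_le_add_left hR.card_le 2

theorem card_center_eq_two_of_card_eq_eight {G : Type*} [Group G] (hG : ¬ IsMulCommutative G)
    (hcard : Nat.card G = 8) : Nat.card (Subgroup.center G) = 2 := by
  have : Finite G := Nat.finite_of_card_ne_zero (by lia)
  have : Nontrivial G := Finite.one_lt_card_iff_nontrivial.1 (by lia)
  have hlt := Finite.one_lt_card_iff_nontrivial.2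
    (IsPGroup.of_card (p := 2) (n := 3) hcard).center_nontrivial
  have hle := four_mul_card_center_le hG
  lia

theorem sq_mem_center_of_card_eq_eight {G : Type*} [Group G] (hG : ¬ IsMulCommutative G)
    (hcard : Nat.card G = 8) (g : G) : g ^ 2 ∈ Subgroup.center G := by
  have hmul := (Subgroup.center G).card_eq_card_quotient_mul_card_subgroup
  rw [hcard, card_center_eq_two_of_card_eq_eight hG hcard] at hmul
  have : Finite (G ⧸ Subgroup.center G) := Nat.finite_of_card_ne_zero (by lia)
  rw [← QuotientGroup.eq_one_iff, QuotientGroup.mk_pow]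
  by_contra hg
  have hcard4 : Nat.card (G ⧸ Subgroup.center G) = 2 ^ 2 := by lia
  have hpow : (g : G ⧸ Subgroup.center G) ^ 2 ^ 2 = 1 := hcard4 ▸ pow_card_eq_one'
  have := isCyclic_of_orderOf_eq_card _
    ((orderOf_eq_prime_pow (p := 2) (n := 1) hg hpow).trans hcard4.symm)
  exact hG (MonoidHom.isMulCommutative_of_isCyclic_of_ker_le_center
    (QuotientGroup.mk' (Subgroup.center G)) (by simp))

theorem exists_orderOf_eq_four_of_card_eq_eight {G : Type*} [Group G] (hG : ¬ IsMulCommutative G)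
    (hcard : Nat.card G = 8) : ∃ g : G, orderOf g = 4 := by
  refine exists_orderOf_eq_four hG fun g => ?_
  have hg : (⟨g ^ 2, sq_mem_center_of_card_eq_eight hG hcard g⟩ : Subgroup.center G) ^ 2 = 1 :=
    orderOf_dvd_iff_pow_eq_one.1
      ((orderOf_dvd_natCard _).trans (card_center_eq_two_of_card_eq_eight hG hcard).dvd)
  rw [pow_mul g 2 2]
  exact congrArg Subtype.val hg

theorem largeDavenport_of_card_eq_eight {G : Type*} [Group G] (hG : ¬ IsMulCommutative G)
    (hcard : Nat.card G = 8) : largeDavenport G = 6 := by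
  have : Finite G := Nat.finite_of_card_ne_zero (by lia)
  have hZ := card_center_eq_two_of_card_eq_eight hG hcard
  have hsq := sq_mem_center_of_card_eq_eight hG hcard
  have hidx : (Subgroup.center G).index = 4 := by
    have := (Subgroup.center G).card_mul_index
    lia
  refine le_antisymm ?_ ?_
  · have hcomm : Nat.card (commutator G) = 2 := by
      have hle := Subgroup.card_le_of_le (commutator_le_of_sq_mem hsq)
      have hne : Nat.card (commutator G) ≠ 1 := fun h => by
        rw [Subgroup.card_eq_one, commutator_eq_bot_iff_center_eq_top] at h
        rw [h, Subgroup.card_top] at hZ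
        lia
      have := Nat.card_pos (α := commutator G)
      lia
    have hexp : ∀ q : G ⧸ Subgroup.center G, q ^ 2 = 1 := fun q => by
      obtain ⟨g, rfl⟩ := QuotientGroup.mk_surjective q
      exact (QuotientGroup.eq_one_iff _).2 (hsq g)
    have := isMulCommutative_of_sq_eq_one hexp
    have hQ := smallDavenport_of_pow_eq_one (r := 2) hexp hidx
    have hd := smallDavenport_le_max_of_sq_mem hZ hsq
    rw [hQ, hidx] at hd
    exact (largeDavenport_le_smallDavenport_add_two hcomm).trans
      ((add_le_add_left hd 2).trans (by norm_num))
  · obtain ⟨a, ha⟩ := exists_orderOf_eq_four_of_card_eq_eight hG hcard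
    exact add_three_le_largeDavenport (K := Subgroup.zpowers a) (k := 3)
      (le_smallDavenport_zpowers (by lia)) (by lia)

/-! ### Recognizing small nonabelian groups -/

section Recognition

variable {G : Type*} [Group G] {n : ℕ}

theorem pow_val_add [NeZero n] {a : G} (ha : a ^ n = 1) (i j : ZMod n) :
    a ^ (i + j).val = a ^ i.val * a ^ j.val := by
  rw [ZMod.val_add, ← pow_add, ← pow_eq_pow_mod _ ha]

theorem pow_val_mul_eq_mul_pow_val_neg [NeZero n] {a x : G} (ha : a ^ n = 1)
    (hxa : x * a * x⁻¹ = a⁻¹) (i : ZMod n) : a ^ i.val * x = x * a ^ (-i).val := by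
  have hneg : a ^ (-i).val = (a ^ i.val)⁻¹ := by
    rw [eq_inv_iff_mul_eq_one, ← pow_val_add ha, neg_add_cancel, ZMod.val_zero, pow_zero]
  have hsemi : SemiconjBy x a⁻¹ a := by
    simpa using (show SemiconjBy x a a⁻¹ from mul_inv_eq_iff_eq_mul.1 hxa).inv_right
  rw [hneg, ← inv_pow]
  exact (hsemi.pow_right _).eq.symm

theorem eq_zero_of_pow_val_eq_one [NeZero n] {a : G} (ha : orderOf a = n) {i : ZMod n}
    (h : a ^ i.val = 1) : i = 0 :=
  (ZMod.val_eq_zero i).1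
    (Nat.eq_zero_of_dvd_of_lt (ha.symm.dvd.trans (orderOf_dvd_of_pow_eq_one h)) i.val_lt)

theorem mul_pow_ne_one_of_notMem_zpowers {a x : G} (hx : x ∉ Subgroup.zpowers a) (k : ℕ) :
    x * a ^ k ≠ 1 := fun h => hx <| by
  rw [mul_eq_one_iff_eq_inv.1 h]
  exact inv_mem (Subgroup.npow_mem_zpowers a k)

theorem nonempty_mulEquiv_dihedralGroup [NeZero n] {a x : G} (ha : orderOf a = n)
    (hx : x ∉ Subgroup.zpowers a) (hx2 : x ^ 2 = 1) (hxa : x * a * x⁻¹ = a⁻¹)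
    (hcard : Nat.card G = 2 * n) : Nonempty (G ≃* DihedralGroup n) := by
  have : Finite G := Nat.finite_of_card_ne_zero (by simp [hcard, NeZero.ne n])
  have han : a ^ n = 1 := ha ▸ pow_orderOf_eq_one a
  have hmul := pow_val_mul_eq_mul_pow_val_neg han hxa
  have hadd := pow_val_add han
  let φ : DihedralGroup n →* G :=
    { toFun
        | .r i => a ^ i.val
        | .sr i => x * a ^ i.val
      map_one' := (congrArg (a ^ ·) ZMod.val_zero).trans (pow_zero a)
      map_mul' := by
        rintro (i | i) (j | j)
        · exact hadd i j
        · simp [← mul_assoc, hmul, mul_assoc x, ← hadd, neg_add_eq_sub]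
        · simp [mul_assoc, ← hadd]
        · rw [← mul_assoc, mul_assoc x, hmul, ← mul_assoc, ← pow_two, hx2, one_mul, ← hadd,
            neg_add_eq_sub, DihedralGroup.sr_mul_sr] }
  have hinj : Function.Injective φ := (injective_iff_map_eq_one φ).2 <| by
    rintro (i | i) hi
    · rw [eq_zero_of_pow_val_eq_one ha hi, DihedralGroup.one_def]
    · exact absurd hi (mul_pow_ne_one_of_notMem_zpowers hx _)
  exact ⟨(MulEquiv.ofBijective φ ((Nat.bijective_iff_injective_and_card φ).2
    ⟨hinj, by rw [DihedralGroup.nat_card, hcard]⟩)).symm⟩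

theorem nonempty_mulEquiv_quaternionGroup [NeZero n] {a x : G} (ha : orderOf a = 2 * n)
    (hx : x ∉ Subgroup.zpowers a) (hx2 : x ^ 2 = a ^ n) (hxa : x * a * x⁻¹ = a⁻¹)
    (hcard : Nat.card G = 4 * n) : Nonempty (G ≃* QuaternionGroup n) := by
  have : Finite G := Nat.finite_of_card_ne_zero (by simp [hcard, NeZero.ne n])
  have han : a ^ (2 * n) = 1 := ha ▸ pow_orderOf_eq_one a
  have hmul := pow_val_mul_eq_mul_pow_val_neg han hxa
  have hadd := pow_val_add han
  have hn : a ^ n = a ^ (n : ZMod (2 * n)).val := by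
    rw [ZMod.val_natCast, ← pow_eq_pow_mod _ han]
  let φ : QuaternionGroup n →* G :=
    { toFun
        | .a i => a ^ i.val
        | .xa i => x * a ^ i.val
      map_one' := (congrArg (a ^ ·) ZMod.val_zero).trans (pow_zero a)
      map_mul' := by
        rintro (i | i) (j | j)
        · exact hadd i j
        · simp [← mul_assoc, hmul, mul_assoc x, ← hadd, neg_add_eq_sub]
        · simp [mul_assoc, ← hadd]
        · rw [← mul_assoc, mul_assoc x, hmul, ← mul_assoc, ← pow_two, hx2, hn, ← hadd, ← hadd,
            QuaternionGroup.xa_mul_xa, add_assoc, neg_add_eq_sub, add_sub_assoc] }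
  have hinj : Function.Injective φ := (injective_iff_map_eq_one φ).2 <| by
    rintro (i | i) hi
    · rw [eq_zero_of_pow_val_eq_one ha hi, QuaternionGroup.one_def]
    · exact absurd hi (mul_pow_ne_one_of_notMem_zpowers hx _)
  exact ⟨(MulEquiv.ofBijective φ ((Nat.bijective_iff_injective_and_card φ).2
    ⟨hinj, by rw [Nat.card_eq_fintype_card, QuaternionGroup.card, hcard]⟩)).symm⟩

theorem isMulCommutative_of_commute_of_index_zpowers_eq_two {a x : G}
    (hidx : (Subgroup.zpowers a).index = 2) (hx : x ∉ Subgroup.zpowers a) (hxa : Commute x a) :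
    IsMulCommutative G := by
  have hpow : ∀ g ∈ Subgroup.zpowers a, Commute g a := by
    rintro _ ⟨k, rfl⟩
    exact (Commute.refl a).zpow_left k
  have hle : Subgroup.zpowers a ≤ Subgroup.center G := by
    rw [Subgroup.zpowers_le, Subgroup.mem_center_iff]
    intro g
    by_cases hg : g ∈ Subgroup.zpowers a
    · exact hpow g hg
    · have hmem : x⁻¹ * g ∈ Subgroup.zpowers a := by
        simp [Subgroup.mul_mem_iff_of_index_two hidx, hx, hg]
      simpa using (hxa.mul_left (hpow _ hmem)).eq
  have := Subgroup.normal_of_index_eq_two hidx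
  have : IsCyclic (G ⧸ Subgroup.zpowers a) := isCyclic_of_prime_card (p := 2) hidx
  exact MonoidHom.isMulCommutative_of_isCyclic_of_ker_le_center
    (QuotientGroup.mk' (Subgroup.zpowers a)) (by rwa [QuotientGroup.ker_mk'])

theorem conj_eq_inv_of_index_zpowers_eq_two (hG : ¬ IsMulCommutative G) {a x : G}
    (ha : orderOf a = 3 ∨ orderOf a = 4) (hidx : (Subgroup.zpowers a).index = 2)
    (hx : x ∉ Subgroup.zpowers a) : x * a * x⁻¹ = a⁻¹ := by
  have hfin : IsOfFinOrder a := orderOf_pos_iff.1 (by lia)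
  obtain ⟨k, hk, hak⟩ := exists_pow_eq_of_mem_zpowers hfin
    ((Subgroup.normal_of_index_eq_two hidx).conj_mem a (Subgroup.mem_zpowers a) x)
  have hk1 : k ≠ 1 := by
    rintro rfl
    rw [pow_one, eq_mul_inv_iff_mul_eq] at hak
    exact hG (isMulCommutative_of_commute_of_index_zpowers_eq_two hidx hx hak.symm)
  have hord : orderOf (a ^ k) = orderOf a := hak ▸ (MulAut.conj x).orderOf_eq a
  rw [← hak, eq_inv_iff_mul_eq_one, ← pow_succ]
  suffices k + 1 = orderOf a from this ▸ pow_orderOf_eq_one a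
  rw [hfin.orderOf_pow] at hord
  rcases ha with ha | ha <;> rw [ha] at hk hord ⊢ <;> interval_cases k <;> simp_all

theorem nonempty_mulEquiv_dihedralGroup_three (hG : ¬ IsMulCommutative G)
    (hcard : Nat.card G = 6) : Nonempty (G ≃* DihedralGroup 3) := by
  have : Finite G := Nat.finite_of_card_ne_zero (by lia)
  obtain ⟨a, ha⟩ := exists_prime_orderOf_dvd_card' (G := G) 3 (by lia)
  obtain ⟨x, hx⟩ := exists_prime_orderOf_dvd_card' (G := G) 2 (by lia)
  have hidx : (Subgroup.zpowers a).index = 2 := by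
    have := (Subgroup.zpowers a).card_mul_index
    rw [Nat.card_zpowers, ha, hcard] at this
    lia
  have hxa : x ∉ Subgroup.zpowers a := fun h => by
    have := orderOf_dvd_of_mem_zpowers h
    rw [hx, ha] at this
    lia
  exact nonempty_mulEquiv_dihedralGroup ha hxa (hx ▸ pow_orderOf_eq_one x)
    (conj_eq_inv_of_index_zpowers_eq_two hG (.inl ha) hidx hxa) hcard

theorem nonempty_mulEquiv_of_card_eq_eight (hG : ¬ IsMulCommutative G) (hcard : Nat.card G = 8) :
    Nonempty (G ≃* QuaternionGroup 2) ∨ Nonempty (G ≃* DihedralGroup 4) := by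
  obtain ⟨a, ha⟩ := exists_orderOf_eq_four_of_card_eq_eight hG hcard
  have hidx : (Subgroup.zpowers a).index = 2 := by
    have := (Subgroup.zpowers a).card_mul_index
    rw [Nat.card_zpowers, ha, hcard] at this
    lia
  obtain ⟨x, hxa⟩ : ∃ x, x ∉ Subgroup.zpowers a := by
    by_contra! h
    rw [(Subgroup.eq_top_iff' _).2 h, Subgroup.index_top] at hidx
    lia
  have hconj := conj_eq_inv_of_index_zpowers_eq_two hG (.inr ha) hidx hxa
  obtain ⟨m, hm, ham⟩ := exists_pow_eq_of_mem_zpowers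
    (orderOf_pos_iff.1 (by lia)) (Subgroup.sq_mem_of_index_two hidx x)
  have hm1 : ¬ Commute x a := fun h =>
    hG (isMulCommutative_of_commute_of_index_zpowers_eq_two hidx hxa h)
  have hcomm : Commute x (a ^ m) := ham ▸ (Commute.refl x).pow_right 2
  rw [ha] at hm
  interval_cases m
  · exact .inr (nonempty_mulEquiv_dihedralGroup ha hxa (by simpa using ham.symm) hconj hcard)
  · exact absurd (by simpa using hcomm) hm1
  · exact .inl (nonempty_mulEquiv_quaternionGroup (n := 2) ha hxa ham.symm hconj hcard)
  · have hinv : a ^ 3 = a⁻¹ := by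
      rw [eq_inv_iff_mul_eq_one, ← pow_succ]
      exact orderOf_dvd_iff_pow_eq_one.1 ha.dvd
    exact absurd (Commute.inv_right_iff.1 (hinv ▸ hcomm)) hm1

end Recognition

/-! ### Abelian groups with small Davenport constant five -/

section Abelian

variable {G : Type*} [Group G]

theorem smallDavenport_add_one_of_isCyclic [Finite G] [IsCyclic G] :
    smallDavenport G + 1 = Nat.card G := by
  obtain ⟨g, hg⟩ := IsCyclic.exists_ofOrder_eq_natCard (α := G)
  refine le_antisymm (smallDavenport_add_one_le_largeDavenport.trans largeDavenport_le_card) ?_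
  have hle := le_smallDavenport_of_lt_orderOf (g := g) (Nat.sub_lt (orderOf_pos g) one_pos)
  rw [← hg, ← Nat.sub_add_cancel (orderOf_pos g), Nat.cast_add_one]
  exact add_le_add_left hle 1

theorem nonempty_mulEquiv_C_card [IsCyclic G] : Nonempty (G ≃* C (Nat.card G)) :=
  ⟨(zmodCyclicMulEquiv ‹_›).symm⟩

theorem isCyclic_of_smallDavenport_eq_five [IsMulCommutative G]
    (hd : smallDavenport G = 5) {p q : ℕ} (hp : p.Prime) (hq : q.Prime) (hpq : p ≠ q)
    (hpG : p ∣ Nat.card G) (hqG : q ∣ Nat.card G) : IsCyclic G := by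
  have : Finite G := finite_of_smallDavenport_le hd.le
  have : Fact p.Prime := ⟨hp⟩
  have : Fact q.Prime := ⟨hq⟩
  obtain ⟨x, hx⟩ := exists_prime_orderOf_dvd_card' p hpG
  obtain ⟨y, hy⟩ := exists_prime_orderOf_dvd_card' q hqG
  have hxy : Commute x y := mul_comm' x y
  have hcop : (orderOf x).Coprime (orderOf y) := by
    rwa [hx, hy, Nat.coprime_primes hp hq]
  by_contra hG
  have hcard : Nat.card G ≠ orderOf x * orderOf y := fun h => hG <|
    isCyclic_of_orderOf_eq_card (x * y) <| by
      rw [h, hxy.orderOf_mul_eq_mul_orderOf_of_coprime hcop]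
  have hle := mul_le_smallDavenport_of_commute hxy hcop hcard
  rw [hd, hx, hy] at hle
  have hle5 : p * q ≤ 5 := by exact_mod_cast hle
  have h2p := hp.two_le
  have h2q := hq.two_le
  rcases hpq.lt_or_gt with h | h <;> nlinarith

theorem exists_equiv_fin_three_apply_two_eq {ι : Type*} [Fintype ι] (h : Fintype.card ι = 3)
    (j : ι) : ∃ σ : Fin 3 ≃ ι, σ 2 = j :=
  let τ := Fintype.equivFinOfCardEq h
  ⟨(Equiv.swap 2 (τ j)).trans τ.symm, by simp⟩

theorem eq_one_or_exists_equiv_fin_three {ι : Type*} [Fintype ι] {e : ι → ℕ}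
    (he : ∀ i, e i ≠ 0) (hsum : ∑ i, (2 ^ e i - 1) = 5) :
    (∀ i, e i = 1) ∨ ∃ σ : Fin 3 ≃ ι, e ∘ σ = ![1, 1, 2] := by
  classical
  refine or_iff_not_imp_left.2 fun hex => ?_
  obtain ⟨j, hj⟩ := not_forall.1 hex
  have hpow : ∀ i, 2 ≤ e i → 4 ≤ 2 ^ e i := fun i hi =>
    Nat.pow_le_pow_right (n := 2) two_pos hi
  rw [← Finset.add_sum_erase _ _ (Finset.mem_univ j)] at hsum
  have hej : e j = 2 := by
    by_contra h
    have : 2 ^ 3 ≤ 2 ^ e j := Nat.pow_le_pow_right two_pos (by have := he j; lia)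
    lia
  rw [hej] at hsum
  have hone : ∀ i ∈ Finset.univ.erase j, e i = 1 := fun i hi => by
    by_contra h
    have := hpow i (by have := he i; lia)
    have := Finset.single_le_sum (f := fun i => 2 ^ e i - 1) (fun _ _ => Nat.zero_le _) hi
    lia
  rw [Finset.sum_congr rfl fun i hi => by rw [hone i hi], Finset.sum_const, smul_eq_mul,
    Finset.card_erase_of_mem (Finset.mem_univ j), Finset.card_univ] at hsum
  obtain ⟨σ, rfl⟩ := exists_equiv_fin_three_apply_two_eq (by lia) j
  have hne : ∀ k, k ≠ 2 → e (σ k) = 1 := fun k hk =>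
    hone _ (Finset.mem_erase.2 ⟨σ.injective.ne hk, Finset.mem_univ _⟩)
  refine ⟨σ, funext fun k => ?_⟩
  fin_cases k
  · exact hne 0 (by decide)
  · exact hne 1 (by decide)
  · exact hej

/-- A product indexed by `Fin 3` as an iterated binary product. -/
def piFinThreeMulEquiv (M : Fin 3 → Type*) [∀ i, Group (M i)] :
    (∀ i, M i) ≃* M 0 × M 1 × M 2 where
  toFun f := (f 0, f 1, f 2)
  invFun x
    | 0 => x.1
    | 1 => x.2.1
    | 2 => x.2.2
  left_inv f := by
    ext k
    fin_cases k <;> rfl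
  right_inv _ := rfl
  map_mul' _ _ := rfl

theorem eq_two_of_sum_pow_sub_one_eq_five {ι : Type*} [Fintype ι] {p : ℕ} (hp : p.Prime)
    {e : ι → ℕ} (hsum : ∑ i, (p ^ e i - 1) = 5) : p = 2 := by
  have hdvd : p - 1 ∣ 5 := hsum ▸ Finset.dvd_sum fun i _ => Nat.sub_one_dvd_pow_sub_one p (e i)
  rcases (Nat.dvd_prime Nat.prime_five).1 hdvd with h | h
  · have := hp.pos
    lia
  · obtain rfl : p = 6 := by lia
    exact absurd hp (by decide)

theorem nonempty_mulEquiv_of_card_eq_prime_pow [IsMulCommutative G]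
    (hd : smallDavenport G = 5) {p n : ℕ} [hp : Fact p.Prime] (h : Nat.card G = p ^ n) :
    Nonempty (G ≃* C 2 × C 2 × C 4) ∨ Nonempty (G ≃* (Fin 5 → C 2)) := by
  obtain ⟨ι, _, e, he, ⟨φ⟩⟩ := exists_mulEquiv_pi_C_of_card_eq_prime_pow h
  have hsum : ∑ i, (p ^ e i - 1) = 5 := by
    rw [smallDavenport_congr φ, smallDavenport_pi_C] at hd
    exact_mod_cast hd
  obtain rfl := eq_two_of_sum_pow_sub_one_eq_five hp.out hsum
  rcases eq_one_or_exists_equiv_fin_three he hsum with he1 | ⟨σ, hσ⟩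
  · have hC : ∀ i (y : C (2 ^ e i)), y ^ 2 = 1 := fun i => by
      rw [he1 i]
      decide
    have hexp : ∀ x : G, x ^ 2 = 1 := fun x => φ.injective <| by
      rw [map_pow, map_one]
      exact funext fun i => hC i _
    rw [smallDavenport_of_pow_eq_one hexp h] at hd
    obtain rfl : n = 5 := by
      have : n * (2 - 1) = 5 := by exact_mod_cast hd
      lia
    exact .inr (nonempty_mulEquiv_pi_of_pow_eq_one hexp h)
  · obtain ⟨ψ⟩ : Nonempty ((∀ i, C (2 ^ e i)) ≃* ∀ k, C (2 ^ (e ∘ σ) k)) :=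
      ⟨⟨(Equiv.piCongrLeft _ σ).symm, fun _ _ => rfl⟩⟩
    rw [hσ] at ψ
    exact .inl ⟨φ.trans (ψ.trans (piFinThreeMulEquiv fun k => C (2 ^ ![1, 1, 2] k)))⟩

theorem nonempty_mulEquiv_of_smallDavenport_eq_five [IsMulCommutative G]
    (hd : smallDavenport G = 5) :
    Nonempty (G ≃* C 6) ∨ Nonempty (G ≃* C 2 × C 2 × C 4) ∨ Nonempty (G ≃* (Fin 5 → C 2)) := by
  have : Finite G := finite_of_smallDavenport_le hd.le
  by_cases hcyc : IsCyclic G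
  · have hcard : Nat.card G = 6 := by
      have := smallDavenport_add_one_of_isCyclic (G := G)
      rw [hd] at this
      exact_mod_cast this.symm
    exact .inl (hcard ▸ nonempty_mulEquiv_C_card)
  have hne : Nat.card G ≠ 1 := fun h => hcyc <|
    have := (Nat.card_eq_one_iff_unique.1 h).1
    inferInstance
  have : Fact (Nat.card G).minFac.Prime := ⟨Nat.minFac_prime hne⟩
  refine .inr (nonempty_mulEquiv_of_card_eq_prime_pow (p := (Nat.card G).minFac) hd
    (Nat.eq_prime_pow_of_unique_prime_dvd Nat.card_pos.ne' fun {q} hq hqG => ?_))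
  by_contra hne
  exact hcyc (isCyclic_of_smallDavenport_eq_five hd hq Fact.out hne hqG (Nat.minFac_dvd _))

end Abelian

/-! ### Classification -/

section Classification

variable {G : Type*} [Group G]

theorem smallDavenport_le_five_of_largeDavenport_le_six (hD : largeDavenport G ≤ 6) :
    smallDavenport G ≤ 5 :=
  (ENat.add_le_add_iff_right ENat.one_ne_top).1 (smallDavenport_add_one_le_largeDavenport.trans hD)

theorem card_eq_six_or_eight (hG : ¬ IsMulCommutative G)
    (hD : largeDavenport G ≤ 6) : Nat.card G = 6 ∨ Nat.card G = 8 := by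
  have hd := smallDavenport_le_five_of_largeDavenport_le_six hD
  have : Finite G := finite_of_smallDavenport_le hd
  have h7 : ¬ 7 ≤ largeDavenport G := fun h => absurd (h.trans hD) (by decide)
  have hZ := four_mul_card_center_le hG
  have hZ0 : 0 < Nat.card (Subgroup.center G) := Nat.card_pos
  rcases card_of_smallDavenport_le_five hd with
    ⟨a, ha, hcard⟩ | ⟨a, -, hcard⟩ | ⟨K, hK, hdK, hcard⟩ | ⟨-, hexp⟩
  · interval_cases a
    · lia
    · lia
    · exact absurd (IsPGroup.isMulCommutative_of_card_eq_prime_sq hcard) hG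
    · exact .inr hcard
    · exact absurd (seven_le_largeDavenport_of_card_eq_sixteen hG hcard) h7
  · have ha : a < 2 := by
      by_contra! ha
      exact h7 (seven_le_largeDavenport_of_card_eq_three_mul ha hcard)
    interval_cases a
    · lia
    · exact .inl hcard
  · exact absurd (seven_le_largeDavenport_of_four_le_smallDavenport hG (by lia) hdK) h7
  · exact absurd (isMulCommutative_of_sq_eq_one hexp) hG

theorem nonempty_mulEquiv_of_largeDavenport_le_six (hG : ¬ IsMulCommutative G)
    (hD : largeDavenport G ≤ 6) :
    Nonempty (G ≃* DihedralGroup 3) ∨ Nonempty (G ≃* QuaternionGroup 2) ∨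
      Nonempty (G ≃* DihedralGroup 4) := by
  rcases card_eq_six_or_eight hG hD with hcard | hcard
  · exact .inl (nonempty_mulEquiv_dihedralGroup_three hG hcard)
  · exact .inr (nonempty_mulEquiv_of_card_eq_eight hG hcard)

theorem largeDavenport_C (n : ℕ) [NeZero n] : largeDavenport (C n) = n := by
  rw [largeDavenport_eq_smallDavenport_add_one, smallDavenport_add_one_of_isCyclic,
    Nat.card_eq_fintype_card, Fintype.card_multiplicative, ZMod.card]

theorem smallDavenport_C_two_prod_C_two_prod_C_four :
    smallDavenport (C 2 × C 2 × C 4) = 5 :=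
  (smallDavenport_congr (piFinThreeMulEquiv fun k => C (2 ^ ![1, 1, 2] k))).symm.trans
    (smallDavenport_pi_C ![1, 1, 2])

theorem smallDavenport_fin_five_C_two : smallDavenport (Fin 5 → C 2) = 5 :=
  smallDavenport_of_pow_eq_one (p := 2) (r := 5) (by decide) (by simp)

theorem largeDavenport_dihedralGroup_three : largeDavenport (DihedralGroup 3) = 6 := by
  refine le_antisymm (largeDavenport_le_card.trans_eq (by rw [DihedralGroup.nat_card]; rfl)) ?_
  exact six_le_largeDavenport_of_mul_mul_eq_inv (r := .r 1) (x := .sr 0) rfl (by decide) rfl rfl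

theorem largeDavenport_quaternionGroup_two : largeDavenport (QuaternionGroup 2) = 6 := by
  refine largeDavenport_of_card_eq_eight (fun h => ?_) ?_
  · exact absurd (mul_comm' (QuaternionGroup.a (n := 2) 1) (.xa 0)) (by decide)
  · rw [Nat.card_eq_fintype_card, QuaternionGroup.card]

theorem largeDavenport_dihedralGroup_four : largeDavenport (DihedralGroup 4) = 6 := by
  refine largeDavenport_of_card_eq_eight (fun h => ?_) DihedralGroup.nat_card
  exact absurd (mul_comm' (DihedralGroup.r (n := 4) 1) (.sr 0)) (by decide)

theorem largeDavenport_eq_six_iff :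
    largeDavenport G = 6 ↔
      Nonempty (G ≃* C 6) ∨ Nonempty (G ≃* C 2 × C 2 × C 4) ∨ Nonempty (G ≃* (Fin 5 → C 2)) ∨
      Nonempty (G ≃* DihedralGroup 3) ∨ Nonempty (G ≃* QuaternionGroup 2) ∨
      Nonempty (G ≃* DihedralGroup 4) := by
  constructor
  · intro hD
    by_cases hG : IsMulCommutative G
    · have hd : smallDavenport G = 5 := by
        rw [largeDavenport_eq_smallDavenport_add_one] at hD
        exact ENat.add_left_injective_of_ne_top ENat.one_ne_top hD
      have := nonempty_mulEquiv_of_smallDavenport_eq_five hd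
      tauto
    · have := nonempty_mulEquiv_of_largeDavenport_le_six hG hD.le
      tauto
  · rintro (⟨⟨φ⟩⟩ | ⟨⟨φ⟩⟩ | ⟨⟨φ⟩⟩ | ⟨⟨φ⟩⟩ | ⟨⟨φ⟩⟩ | ⟨⟨φ⟩⟩) <;> rw [largeDavenport_congr φ]
    · exact largeDavenport_C 6
    · rw [largeDavenport_eq_smallDavenport_add_one, smallDavenport_C_two_prod_C_two_prod_C_four]
      rfl
    · rw [largeDavenport_eq_smallDavenport_add_one, smallDavenport_fin_five_C_two]
      rfl
    · exact largeDavenport_dihedralGroup_three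
    · exact largeDavenport_quaternionGroup_two
    · exact largeDavenport_dihedralGroup_four

theorem isMulCommutative_of_largeDavenport_le_five (hD : largeDavenport G ≤ 5) :
    IsMulCommutative G := by
  by_contra hG
  have h6 : largeDavenport G = 6 := by
    have := nonempty_mulEquiv_of_largeDavenport_le_six hG (hD.trans (by decide))
    exact largeDavenport_eq_six_iff.2 (.inr (.inr (.inr this)))
  exact absurd (h6 ▸ hD) (by decide)

theorem nonempty_mulEquiv_fin_five_C_two (hcard : 32 ≤ ENat.card G)
    (hd : smallDavenport G ≤ 5) : Nonempty (G ≃* (Fin 5 → C 2)) := by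
  have : Finite G := finite_of_smallDavenport_le hd
  have hcard' : 32 ≤ Nat.card G := by
    rw [ENat.card_eq_coe_natCard] at hcard
    exact_mod_cast hcard
  rcases card_of_smallDavenport_le_five hd with
    ⟨a, ha, h⟩ | ⟨a, ha, h⟩ | ⟨_, -, -, h⟩ | ⟨h, hexp⟩
  · have := Nat.pow_le_pow_right (n := 2) two_pos ha
    lia
  · have := Nat.pow_le_pow_right (n := 2) two_pos ha
    lia
  · lia
  · have := isMulCommutative_of_sq_eq_one hexp
    exact nonempty_mulEquiv_pi_of_pow_eq_one hexp h

end Classification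

end GroupSequence

open GroupSequence in
theorem lemma4p6_general (G : Type*) [Group G] :
    (32 ≤ ENat.card G →
      (Nonempty (G ≃* (Fin 5 → C 2)) ∧ smallDavenport G = 5) ∨ 6 ≤ smallDavenport G) ∧
    (largeDavenport G = 6 ↔
      Nonempty (G ≃* C 6) ∨ Nonempty (G ≃* C 2 × C 2 × C 4) ∨ Nonempty (G ≃* (Fin 5 → C 2)) ∨
      Nonempty (G ≃* DihedralGroup 3) ∨ Nonempty (G ≃* QuaternionGroup 2) ∨
      Nonempty (G ≃* DihedralGroup 4)) ∧
    (largeDavenport G ≤ 5 → ∀ a b : G, a * b = b * a) := by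
  refine ⟨fun hcard => or_iff_not_imp_right.2 fun hd => ?_, largeDavenport_eq_six_iff, fun hD =>
    isMulCommutative_iff.1 (isMulCommutative_of_largeDavenport_le_five hD)⟩
  have hd5 : smallDavenport G ≤ 5 := Order.le_of_lt_add_one (not_le.1 hd)
  obtain ⟨φ⟩ := nonempty_mulEquiv_fin_five_C_two hcard hd5
  exact ⟨⟨φ⟩, (smallDavenport_congr φ).trans smallDavenport_fin_five_C_two⟩

theorem lemma4p6 (G : Type*) [Group G] [Finite G] :
    (32 ≤ Nat.card G →
      (Nonempty (G ≃* (Fin 5 → GroupSequence.C 2)) ∧ GroupSequence.smallDavenport G = 5) ∨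
        6 ≤ GroupSequence.smallDavenport G) ∧
    (GroupSequence.largeDavenport G = 6 ↔
      Nonempty (G ≃* GroupSequence.C 6) ∨
      Nonempty (G ≃* GroupSequence.C 2 × GroupSequence.C 2 × GroupSequence.C 4) ∨
      Nonempty (G ≃* (Fin 5 → GroupSequence.C 2)) ∨
      Nonempty (G ≃* DihedralGroup 3) ∨
      Nonempty (G ≃* QuaternionGroup 2) ∨
      Nonempty (G ≃* DihedralGroup 4)) ∧
    (GroupSequence.largeDavenport G ≤ 5 → ∀ a b : G, a * b = b * a) := by
  have h := lemma4p6_general G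
  rw [ENat.card_eq_coe_natCard] at h
  exact ⟨fun hcard => h.1 (by exact_mod_cast hcard), h.2⟩
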